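/- **Setting.** Let $\mathcal H$ be a complex Hilbert space and $h$ a self-adjoint operator on $\mathcal H$ with compact resolvent, bounded below. Let $\{\psi_j\}_{j\in\mathcal J}$ be an orthonormal basis of $\mathcal H$ with $h\psi_j=e_j\psi_j$. Let $\mathcal H_N=\mathcal H^{\otimes N}$, $H_N=\sum_{j=1}^N h_j$ (with $h_j$ acting as $h$ on the $j$th factor), and for $\alpha\in\mathcal J^N$ let $\Psi_\alpha=\psi_{\alpha_1}\otimes\cdots\otimes\psi_{\alpha_N}$. Let $P_E$ be the orthogonal projection onto the eigenspace of $H_N$ with eigenvalue $E$, and let $\mathcal A_N$ be the algebra of bounded operators $\sum_E f(E)P_E$ with $f$ bounded (strongly convergent sums). A *collision specification* $(\mathcal C,U,\nu)$ consists of a compact metric space $\mathcal C$, a (strongly) continuous one-to-one map $U$ from $\mathcal C$ to the unitary group of $\mathcal H_2$, and a Borel probability measure $\nu$ on $\mathcal C$ charging every non-empty open set, such that (i) each $U(\sigma)$ commutes with $H_2$; (ii) $U(\sigma_0)=1$ for some $\sigma_0$; (iii) $\{U(\sigma)^*\}=\{U(\sigma)\}$ and the map $\sigma\mapsto\sigma'$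 with $U(\sigma)^*=U(\sigma')$ is measurable and preserves $\nu$; (iv) the same holds with $VU(\sigma)V^*$ in place of $U(\sigma)^*$, where $V(\phi\otimes\psi)=\psi\otimes\phi$. It is *ergodic* if the commutant $\{U(\sigma):\sigma\in\mathcal C\}'$ in the bounded operators on $\mathcal H_2$ equals $\mathcal A_2$. Let $N\ge 2$. For $i<j$ let $U_{i,j}(\sigma)$ be $U(\sigma)$ acting on the factors $i,j$ of $\mathcal H_N$, and for bounded $A$ on $\mathcal H_N$ put $$\mathcal L_N A=N\Bigl(\tbinom N2^{-1}\sum_{i<j}\int_{\mathcal C}U_{i,j}(\sigma)\,A\,U_{i,j}(\sigma)^*\,d\nu(\sigma)-A\Bigr),$$ the integral being taken in the strong operator topology. Let $\mathcal C_N=\{U_{i,j}(\sigma): i<j,\ \sigma\in\mathcal C\}'$. A non-zero orthogonal projection $P\in\mathcal C_N$ is *minimal* if every non-zero orthogonal projection $Q\in\mathcal C_N$ with $Q\le P$ equals $P$. Indices $\alpha,\alpha'\in\mathcal J^N$ are *adjacent* if for some $i<j$ one has $e_{\alpha_i}+e_{\alpha_j}=e_{\alpha'_i}+e_{\alpha'_j}$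 and $\alpha_k=\alpha'_k$ for all $k\ne i,j$; they are *equivalent*, $\alpha\sim\alpha'$, if they are joined by a finite sequence of successively adjacent indices. A density matrix is a positive trace class operator of trace $1$. **Theorem.** Let $(\mathcal C,U,\nu)$ be an ergodic collision specification and $N\ge2$. Then: 1. Every equivalence class of $\sim$ in $\mathcal J^N$ is finite, and the minimal projections of $\mathcal C_N$ are exactly the operators $P=\sum_{\alpha\sim\alpha_0}|\Psi_\alpha\rangle\langle\Psi_\alpha|$ with $\alpha_0\in\mathcal J^N$. In particular each minimal projection $P$ has finite rank, and $P/\operatorname{Tr}P$ is a density matrix. 2. A density matrix $\varrho$ on $\mathcal H_N$ satisfies $\mathcal L_N\varrho=0$ if and only if it is a (finite or countably infinite) convex combination of normalized minimal projections of $\mathcal C_N$, i.e. $\varrho=\sum_P w_P\,P/\operatorname{Tr}P$, the sum being over the minimal projections $P$ of $\mathcal C_N$, with $w_P\ge0$ and $\sum_P w_P=1$. (The series converges in operator norm, equivalently in trace norm.) -/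

import Mathlib

open scoped InnerProductSpace

noncomputable section

namespace QKac

open MeasureTheory Filter Topology

/-! ### Square-summable families and amplification of operators -/

/-- `ℓ²(X)` with complex coefficients. -/
abbrev L2 (X : Type*) : Type _ := lp (fun _ : X => ℂ) 2

section Amplification

variable {X Y Z : Type*}

theorem memL2_iff {f : Z → ℂ} : Memℓp f 2 ↔ Summable fun z => ‖f z‖ ^ 2 := by
  rw [memℓp_gen_iff (by norm_num)]
  simp

theorem L2.summable_sq (f : L2 Z) : Summable fun z => ‖f z‖ ^ 2 := memL2_iff.1 (lp.memℓp f)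

theorem L2.norm_sq (f : L2 Z) : ‖f‖ ^ 2 = ∑' z, ‖f z‖ ^ 2 := by
  have h := lp.norm_rpow_eq_tsum (p := 2) (by norm_num) f
  simpa using h

/-- For an identification `E : X × Y ≃ Z`, the slice `y ↦ f (E (x, y))` of `f ∈ ℓ²(Z)`. -/
def slice (E : X × Y ≃ Z) (f : L2 Z) (x : X) : L2 Y :=
  ⟨fun y => f (E (x, y)), memL2_iff.2
    ((L2.summable_sq f).comp_injective (i := fun y => E (x, y)) fun _ _ h => by
      simpa using h)⟩

@[simp] theorem slice_apply (E : X × Y ≃ Z) (f : L2 Z) (x : X) (y : Y) :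
    slice E f x y = f (E (x, y)) := rfl

theorem slice_add (E : X × Y ≃ Z) (f g : L2 Z) (x : X) :
    slice E (f + g) x = slice E f x + slice E g x := by ext y; simp

theorem slice_smul (E : X × Y ≃ Z) (c : ℂ) (f : L2 Z) (x : X) :
    slice E (c • f) x = c • slice E f x := by ext y; simp

theorem summable_slice (E : X × Y ≃ Z) (f : L2 Z) : Summable fun x => ‖slice E f x‖ ^ 2 := by
  have h := (E.summable_iff (f := fun z => ‖f z‖ ^ 2)).2 (L2.summable_sq f)
  have h2 := ((summable_prod_of_nonneg (fun x => sq_nonneg ‖f (E x)‖)).1 h).2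
  simpa [L2.norm_sq] using h2

theorem norm_sq_eq_tsum_slice (E : X × Y ≃ Z) (f : L2 Z) :
    ‖f‖ ^ 2 = ∑' x, ‖slice E f x‖ ^ 2 := by
  have h := (E.summable_iff (f := fun z => ‖f z‖ ^ 2)).2 (L2.summable_sq f)
  have h2 := h.tsum_prod
  rw [L2.norm_sq, ← E.tsum_eq]
  refine h2.trans (tsum_congr fun x => ?_)
  rw [L2.norm_sq]
  rfl

theorem amp_mem (E : X × Y ≃ Z) (A : L2 Y →L[ℂ] L2 Y) (f : L2 Z) :
    Memℓp (fun z => A (slice E f (E.symm z).1) (E.symm z).2) 2 := by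
  rw [memL2_iff, ← E.summable_iff]
  refine (summable_prod_of_nonneg (fun x => sq_nonneg
    ‖A (slice E f (E.symm (E x)).1) (E.symm (E x)).2‖)).2 ⟨fun x => ?_, ?_⟩
  · refine (L2.summable_sq (A (slice E f x))).congr fun y => ?_
    rw [E.symm_apply_apply]
  · have : ∀ x, ∑' y, ((fun z => ‖A (slice E f (E.symm z).1) (E.symm z).2‖ ^ 2) ∘ E) (x, y)
        = ‖A (slice E f x)‖ ^ 2 := fun x => by
      rw [L2.norm_sq]
      refine tsum_congr fun y => ?_
      simp only [Function.comp_apply, E.symm_apply_apply]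
    refine Summable.congr ?_ fun x => (this x).symm
    refine Summable.of_nonneg_of_le (fun _ => by positivity) (fun x => ?_)
      ((summable_slice E f).mul_left (‖A‖ ^ 2))
    rw [← mul_pow]
    gcongr
    exact A.le_opNorm _

/-- The operator on `ℓ²(Z) ≅ ℓ²(X) ⊗ ℓ²(Y)` acting as `1 ⊗ A`: apply `A` to every slice. -/
def ampFun (E : X × Y ≃ Z) (A : L2 Y →L[ℂ] L2 Y) (f : L2 Z) : L2 Z :=
  ⟨fun z => A (slice E f (E.symm z).1) (E.symm z).2, amp_mem E A f⟩

theorem slice_ampFun (E : X × Y ≃ Z) (A : L2 Y →L[ℂ] L2 Y) (f : L2 Z) (x : X) :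
    slice E (ampFun E A f) x = A (slice E f x) := by
  ext y; simp [ampFun]

theorem norm_ampFun_le (E : X × Y ≃ Z) (A : L2 Y →L[ℂ] L2 Y) (f : L2 Z) :
    ‖ampFun E A f‖ ≤ ‖A‖ * ‖f‖ := by
  refine le_of_sq_le_sq ?_ (by positivity)
  rw [mul_pow, norm_sq_eq_tsum_slice E, norm_sq_eq_tsum_slice E f, ← tsum_mul_left]
  have hs := summable_slice E (ampFun E A f)
  simp_rw [slice_ampFun] at hs ⊢
  refine hs.tsum_le_tsum (fun x => ?_) ((summable_slice E f).mul_left _)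
  rw [← mul_pow]
  gcongr
  exact A.le_opNorm _

/-- The amplification `1 ⊗ A` of a bounded operator `A` on `ℓ²(Y)` to `ℓ²(Z) ≅ ℓ²(X) ⊗ ℓ²(Y)`. -/
def amp (E : X × Y ≃ Z) (A : L2 Y →L[ℂ] L2 Y) : L2 Z →L[ℂ] L2 Z :=
  LinearMap.mkContinuous
    { toFun := ampFun E A
      map_add' := fun f g => by
        ext z
        change A (slice E (f + g) _) _ = A (slice E f _) _ + A (slice E g _) _
        simp [slice_add]
      map_smul' := fun c f => by ext z; simp [ampFun, slice_smul] }
    ‖A‖ (norm_ampFun_le E A)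

theorem amp_apply (E : X × Y ≃ Z) (A : L2 Y →L[ℂ] L2 Y) (f : L2 Z) (z : Z) :
    amp E A f z = A (slice E f (E.symm z).1) (E.symm z).2 := rfl

theorem slice_amp (E : X × Y ≃ Z) (A : L2 Y →L[ℂ] L2 Y) (f : L2 Z) (x : X) :
    slice E (amp E A f) x = A (slice E f x) := slice_ampFun E A f x

theorem slice_ext (E : X × Y ≃ Z) {f g : L2 Z} (h : ∀ x, slice E f x = slice E g x) : f = g := by
  ext z
  have := congrArg (fun k : L2 Y => k (E.symm z).2) (h (E.symm z).1)
  simpa using this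

theorem amp_one (E : X × Y ≃ Z) : amp E 1 = 1 := by
  ext1 f
  exact slice_ext E fun x => by simp [slice_amp]

theorem amp_mul (E : X × Y ≃ Z) (A B : L2 Y →L[ℂ] L2 Y) :
    amp E (A * B) = amp E A * amp E B := by
  ext1 f
  exact slice_ext E fun x => by simp [slice_amp]

theorem inner_eq_tsum_slice (E : X × Y ≃ Z) (f g : L2 Z) :
    ⟪f, g⟫_ℂ = ∑' x, ⟪slice E f x, slice E g x⟫_ℂ := by
  have h := (E.summable_iff (f := fun z => ⟪f z, g z⟫_ℂ)).2 (lp.summable_inner f g)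
  have h2 := h.tsum_prod
  rw [lp.inner_eq_tsum, ← E.tsum_eq]
  exact h2

theorem amp_star (E : X × Y ≃ Z) (A : L2 Y →L[ℂ] L2 Y) : amp E (star A) = star (amp E A) := by
  rw [ContinuousLinearMap.star_eq_adjoint, ContinuousLinearMap.star_eq_adjoint,
    ContinuousLinearMap.eq_adjoint_iff]
  intro f g
  rw [inner_eq_tsum_slice E, inner_eq_tsum_slice E]
  simp_rw [slice_amp, ContinuousLinearMap.adjoint_inner_left]

theorem amp_mem_unitary (E : X × Y ≃ Z) {A : L2 Y →L[ℂ] L2 Y} (hA : A ∈ unitary (L2 Y →L[ℂ] L2 Y)) :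
    amp E A ∈ unitary (L2 Z →L[ℂ] L2 Z) := by
  rw [Unitary.mem_iff] at hA ⊢
  rw [← amp_star, ← amp_mul, ← amp_mul, hA.1, hA.2, amp_one]
  exact ⟨rfl, rfl⟩

theorem norm_apply_le_of_mem_unitary {K : Type*} [NormedAddCommGroup K] [InnerProductSpace ℂ K]
    [CompleteSpace K] {W : K →L[ℂ] K} (hW : W ∈ unitary (K →L[ℂ] K)) (v : K) : ‖W v‖ ≤ ‖v‖ :=
  (ContinuousLinearMap.norm_map_of_mem_unitary hW v).le

theorem continuous_amp {C : Type*} [TopologicalSpace C] (E : X × Y ≃ Z)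
    {U : C → L2 Y →L[ℂ] L2 Y} (hU : ∀ σ, U σ ∈ unitary (L2 Y →L[ℂ] L2 Y))
    (hc : ∀ v, Continuous fun σ => U σ v) (f : L2 Z) : Continuous fun σ => amp E (U σ) f := by
  rw [continuous_iff_continuousAt]
  intro σ₀
  rw [ContinuousAt, tendsto_iff_norm_sub_tendsto_zero]
  have key : Tendsto (fun σ => ‖amp E (U σ) f - amp E (U σ₀) f‖ ^ 2) (𝓝 σ₀) (𝓝 0) := by
    have h1 : ∀ σ, ‖amp E (U σ) f - amp E (U σ₀) f‖ ^ 2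
        = ∑' x, ‖U σ (slice E f x) - U σ₀ (slice E f x)‖ ^ 2 := fun σ => by
      rw [norm_sq_eq_tsum_slice E]
      refine tsum_congr fun x => ?_
      have : slice E (amp E (U σ) f - amp E (U σ₀) f) x
          = slice E (amp E (U σ) f) x - slice E (amp E (U σ₀) f) x := by ext y; simp
      rw [this, slice_amp, slice_amp]
    simp_rw [h1]
    have h0 : (0 : ℝ) = ∑' _ : X, (0 : ℝ) := by simp
    rw [h0]
    refine tendsto_tsum_of_dominated_convergence (bound := fun x => (2 * ‖slice E f x‖) ^ 2) ?_ ?_ ?_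
    · simp_rw [mul_pow]
      exact (summable_slice E f).mul_left _
    · intro x
      have := ((hc (slice E f x)).tendsto σ₀)
      rw [tendsto_iff_norm_sub_tendsto_zero] at this
      simpa using this.pow 2
    · refine Eventually.of_forall fun σ x => ?_
      rw [Real.norm_of_nonneg (by positivity)]
      gcongr
      calc _ ≤ ‖U σ (slice E f x)‖ + ‖U σ₀ (slice E f x)‖ := norm_sub_le _ _
        _ ≤ ‖slice E f x‖ + ‖slice E f x‖ := by
          gcongr <;> exact norm_apply_le_of_mem_unitary (hU _) _
        _ = _ := by ring
  have := key.sqrt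
  simpa using this

theorem continuous_star_apply {C K : Type*} [TopologicalSpace C] [NormedAddCommGroup K]
    [InnerProductSpace ℂ K] [CompleteSpace K] {W : C → K →L[ℂ] K}
    (hW : ∀ σ, W σ ∈ unitary (K →L[ℂ] K)) (hc : ∀ v, Continuous fun σ => W σ v) (v : K) :
    Continuous fun σ => (star (W σ)) v := by
  rw [continuous_iff_continuousAt]
  intro σ₀
  rw [ContinuousAt, tendsto_iff_norm_sub_tendsto_zero]
  set w := star (W σ₀) v with hw
  have hv : W σ₀ w = v := by
    have := congrArg (fun T : K →L[ℂ] K => T v) (Unitary.mem_iff.1 (hW σ₀)).2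
    simpa using this
  have h0 : Tendsto (fun σ => ‖W σ w - v‖) (𝓝 σ₀) (𝓝 0) := by
    have := (hc w).tendsto σ₀
    rw [hv] at this
    exact tendsto_iff_norm_sub_tendsto_zero.1 this
  refine squeeze_zero (fun _ => norm_nonneg _) (fun σ => ?_) h0
  have h1 : star (W σ) v - w = star (W σ) (v - W σ w) := by
    have := congrArg (fun T : K →L[ℂ] K => T w) (Unitary.mem_iff.1 (hW σ)).1
    simp only [mul_apply_eq_comp, one_apply_eq_self] at this
    rw [map_sub, this]
  rw [h1, norm_sub_rev (W σ w)]
  exact norm_apply_le_of_mem_unitary (Unitary.star_mem (hW σ)) _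

theorem continuous_conj_apply {C K : Type*} [TopologicalSpace C] [NormedAddCommGroup K]
    [InnerProductSpace ℂ K] [CompleteSpace K] {W : C → K →L[ℂ] K}
    (hW : ∀ σ, W σ ∈ unitary (K →L[ℂ] K)) (hc : ∀ v, Continuous fun σ => W σ v)
    (A : K →L[ℂ] K) (v : K) :
    Continuous fun σ => W σ (A (star (W σ) v)) := by
  have hg : Continuous fun σ => A (star (W σ) v) :=
    A.continuous.comp (continuous_star_apply hW hc v)
  rw [continuous_iff_continuousAt]
  intro σ₀
  rw [ContinuousAt, tendsto_iff_norm_sub_tendsto_zero]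
  have h1 := tendsto_iff_norm_sub_tendsto_zero.1 (hg.tendsto σ₀)
  have h2 := tendsto_iff_norm_sub_tendsto_zero.1 ((hc (A (star (W σ₀) v))).tendsto σ₀)
  have h3 := h1.add h2
  rw [add_zero] at h3
  refine squeeze_zero (fun _ => norm_nonneg _) (fun σ => ?_) h3
  have : W σ (A (star (W σ) v)) - W σ₀ (A (star (W σ₀) v))
      = W σ (A (star (W σ) v) - A (star (W σ₀) v))
        + (W σ (A (star (W σ₀) v)) - W σ₀ (A (star (W σ₀) v))) := by
    rw [map_sub]; abel
  rw [this]
  refine (norm_add_le _ _).trans ?_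
  gcongr
  exact norm_apply_le_of_mem_unitary (hW σ) _

end Amplification

/-! ### The Hilbert tensor powers

The `N`-fold Hilbert space tensor power of a Hilbert space with orthonormal basis `(ψ_j)_{j ∈ J}` is
realized as `ℓ²(J^N)`: a vector is given by its coordinates with respect to
`ψ_{α₁} ⊗ ⋯ ⊗ ψ_{α_N}`. -/

/-- The space `𝓗_N = 𝓗^{⊗ N}`, for a Hilbert space `𝓗` with an orthonormal basis indexed
by `J`. -/
abbrev HN (J : Type*) (N : ℕ) : Type _ := L2 (Fin N → J)

section Tensor

variable {J H : Type*} [NormedAddCommGroup H] [InnerProductSpace ℂ H]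

theorem hasSum_pi_prod {R : Type*} [NormedCommRing R] [NormOneClass R] [CompleteSpace R] (N : ℕ)
    (a : Fin N → J → R) (ha : ∀ i, Summable fun j => ‖a i j‖) :
    (Summable fun α : Fin N → J => ‖∏ i, a i (α i)‖) ∧
      HasSum (fun α : Fin N → J => ∏ i, a i (α i)) (∏ i, ∑' j, a i j) := by
  induction N with
  | zero => exact ⟨(hasSum_fintype _).summable, by simp⟩
  | succ N ih =>
    obtain ⟨h1, h2⟩ := ih (fun i => a i.succ) fun i => ha i.succ
    set g : (Fin N → J) → R := fun α => ∏ i, a i.succ (α i) with hg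
    have h3 : Summable fun x : J × (Fin N → J) => a 0 x.1 * g x.2 :=
      summable_mul_of_summable_norm (ha 0) h1
    have h4 : Summable fun x : J × (Fin N → J) => ‖a 0 x.1 * g x.2‖ := (ha 0).mul_norm h1
    have hE : ∀ x : J × (Fin N → J), (∏ i, a i ((Fin.consEquiv fun _ => J) x i))
        = a 0 x.1 * g x.2 := fun x => by
      simp [Fin.prod_univ_succ, Fin.consEquiv, hg]
    constructor
    · rw [← (Fin.consEquiv fun _ => J).summable_iff]
      exact h4.congr fun x => by rw [Function.comp_apply, hE]
    · rw [← (Fin.consEquiv fun _ => J).hasSum_iff, Fin.prod_univ_succ]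
      have h5 : HasSum (a 0) (∑' j, a 0 j) := (ha 0).of_norm.hasSum
      have h6 := h5.mul h2 h3
      have h7 : (fun α : Fin (N + 1) → J => ∏ i, a i (α i)) ∘ (Fin.consEquiv fun _ => J)
          = fun x : J × (Fin N → J) => a 0 x.1 * g x.2 := funext hE
      rw [h7]
      exact h6

theorem tprod_mem (ψ : HilbertBasis J ℂ H) {N : ℕ} (φ : Fin N → H) :
    Memℓp (fun α : Fin N → J => ∏ i, ⟪ψ (α i), φ i⟫_ℂ) 2 := by
  rw [memL2_iff]
  have h : ∀ i, Summable fun j => ‖‖⟪ψ j, φ i⟫_ℂ‖ ^ 2‖ := fun i => by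
    have := L2.summable_sq (ψ.repr (φ i))
    simpa [ψ.repr_apply_apply] using this
  refine ((hasSum_pi_prod N (fun i j => ‖⟪ψ j, φ i⟫_ℂ‖ ^ 2) h).2.summable).congr fun α => ?_
  rw [Finset.prod_pow, norm_prod]

/-- The product vector `φ₁ ⊗ ⋯ ⊗ φ_N`. -/
def tprod (ψ : HilbertBasis J ℂ H) {N : ℕ} (φ : Fin N → H) : HN J N :=
  ⟨fun α => ∏ i, ⟪ψ (α i), φ i⟫_ℂ, tprod_mem ψ φ⟩

@[simp] theorem tprod_apply (ψ : HilbertBasis J ℂ H) {N : ℕ} (φ : Fin N → H) (α : Fin N → J) :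
    tprod ψ φ α = ∏ i, ⟪ψ (α i), φ i⟫_ℂ := rfl

/-- The inner product of product vectors; with `basisVec_apply` and multilinearity (immediate from
the definition) it identifies `HN J N` as the Hilbert space tensor power. -/
theorem inner_tprod (ψ : HilbertBasis J ℂ H) {N : ℕ} (φ χ : Fin N → H) :
    ⟪tprod ψ φ, tprod ψ χ⟫_ℂ = ∏ i, ⟪φ i, χ i⟫_ℂ := by
  have h : ∀ i, Summable fun j => ‖⟪φ i, ψ j⟫_ℂ * ⟪ψ j, χ i⟫_ℂ‖ := fun i =>
    (ψ.summable_inner_mul_inner (φ i) (χ i)).norm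
  have h2 := (hasSum_pi_prod N (fun i j => ⟪φ i, ψ j⟫_ℂ * ⟪ψ j, χ i⟫_ℂ) h).2.tsum_eq
  simp_rw [ψ.tsum_inner_mul_inner] at h2
  rw [← h2, lp.inner_eq_tsum]
  refine tsum_congr fun α => ?_
  rw [Finset.prod_mul_distrib, tprod_apply, tprod_apply, RCLike.inner_apply, mul_comm, map_prod]
  simp

/-- The basis vectors `Ψ_α = ψ_{α₁} ⊗ ⋯ ⊗ ψ_{α_N}`. -/
def basisVec (ψ : HilbertBasis J ℂ H) {N : ℕ} (α : Fin N → J) : HN J N :=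
  tprod ψ fun i => ψ (α i)

open Classical in
theorem basisVec_apply (ψ : HilbertBasis J ℂ H) {N : ℕ} (α β : Fin N → J) :
    basisVec ψ α β = if β = α then 1 else 0 := by
  have h : ∀ i, ⟪ψ (β i), ψ (α i)⟫_ℂ = if β i = α i then 1 else 0 := fun i =>
    orthonormal_iff_ite.1 ψ.orthonormal _ _
  simp only [basisVec, tprod_apply, h, Finset.prod_ite_zero, funext_iff]
  simp

end Tensor

/-! ### Operators acting on two of the `N` factors -/

/-- Pairs `(i, j)` with `i < j`. -/
abbrev Pair (N : ℕ) : Type := {p : Fin N × Fin N // p.1 < p.2}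

open Classical in
/-- The identification `J^N ≅ J^{k ≠ i, j} × J²`, the last factor holding the coordinates
`i` and `j`, in this order. -/
def pairEquiv (J : Type*) {N : ℕ} (p : Pair N) :
    ({k : Fin N // k ≠ p.1.1 ∧ k ≠ p.1.2} → J) × (Fin 2 → J) ≃ (Fin N → J) where
  toFun x k := if h1 : k = p.1.1 then x.2 0 else if h2 : k = p.1.2 then x.2 1 else x.1 ⟨k, h1, h2⟩
  invFun α := (fun k => α k.1, ![α p.1.1, α p.1.2])
  left_inv x := by
    have hne : p.1.2 ≠ p.1.1 := p.2.ne'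
    refine Prod.ext ?_ ?_
    · funext k
      simp [k.2.1, k.2.2]
    · funext k
      fin_cases k <;> simp [hne]
  right_inv α := by
    funext k
    by_cases h1 : k = p.1.1
    · simp [h1]
    · by_cases h2 : k = p.1.2
      · subst h2; simp [h1]
      · simp [h1, h2]

/-- For a bounded operator `A` on `𝓗_2`, the operator `A_{i,j}` on `𝓗_N` acting as `A` on the
factors `i` and `j` and trivially on the others. -/
def pairOp {J : Type*} {N : ℕ} (p : Pair N) (A : HN J 2 →L[ℂ] HN J 2) : HN J N →L[ℂ] HN J N :=
  amp (pairEquiv J p) A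

/-- The action of `A_{i,j}` on product vectors, in coordinates. -/
theorem pairOp_tprod {J H : Type*} [NormedAddCommGroup H] [InnerProductSpace ℂ H]
    (ψ : HilbertBasis J ℂ H) {N : ℕ} (p : Pair N) (A : HN J 2 →L[ℂ] HN J 2) (φ : Fin N → H)
    (α : Fin N → J) :
    pairOp p A (tprod ψ φ) α
      = A (tprod ψ ![φ p.1.1, φ p.1.2]) ![α p.1.1, α p.1.2]
        * ∏ k ∈ Finset.univ.erase p.1.1 |>.erase p.1.2, ⟪ψ (α k), φ k⟫_ℂ := by
  have hne : p.1.2 ≠ p.1.1 := p.2.ne'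
  have hs : slice (pairEquiv J p) (tprod ψ φ) (fun k => α k.1)
      = (∏ k ∈ Finset.univ.erase p.1.1 |>.erase p.1.2, ⟪ψ (α k), φ k⟫_ℂ)
        • tprod ψ ![φ p.1.1, φ p.1.2] := by
    ext β
    rw [slice_apply, tprod_apply, lp.coeFn_smul, Pi.smul_apply, tprod_apply, smul_eq_mul,
      Fin.prod_univ_two, ← Finset.mul_prod_erase _ _ (Finset.mem_univ p.1.1),
      ← Finset.mul_prod_erase _ _ (Finset.mem_erase.2 ⟨hne, Finset.mem_univ p.1.2⟩),
      ← mul_assoc, mul_comm]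
    congr 1
    · refine Finset.prod_congr rfl fun k hk => ?_
      simp only [Finset.mem_erase] at hk
      simp [pairEquiv, hk.1, hk.2.1]
    · simp [pairEquiv, hne]
  change A (slice (pairEquiv J p) (tprod ψ φ) (fun k => α k.1)) ![α p.1.1, α p.1.2] = _
  rw [hs, map_smul, lp.coeFn_smul, Pi.smul_apply, smul_eq_mul, mul_comm]

/-- The swap `V (φ ⊗ χ) = χ ⊗ φ` on `𝓗_2`. -/
def swap (J : Type*) : HN J 2 →L[ℂ] HN J 2 :=
  LinearMap.mkContinuous
    { toFun := fun f => ⟨fun β => f (β ∘ Equiv.swap 0 1), memL2_iff.2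
        (((Equiv.swap (0 : Fin 2) 1).arrowCongr (Equiv.refl J)).summable_iff.2
          (L2.summable_sq f))⟩
      map_add' := fun f g => rfl
      map_smul' := fun c f => rfl }
    1 (fun f => by
      refine le_of_sq_le_sq ?_ (by positivity)
      rw [one_mul, L2.norm_sq, L2.norm_sq f]
      exact (((Equiv.swap (0 : Fin 2) 1).arrowCongr (Equiv.refl J)).tsum_eq
        fun β => ‖f β‖ ^ 2).le)

theorem swap_tprod {J H : Type*} [NormedAddCommGroup H] [InnerProductSpace ℂ H]
    (ψ : HilbertBasis J ℂ H) (φ χ : H) : swap J (tprod ψ ![φ, χ]) = tprod ψ ![χ, φ] := by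
  ext β
  change tprod ψ ![φ, χ] (β ∘ Equiv.swap 0 1) = _
  simp [Fin.prod_univ_two, mul_comm]

/-! ### The Hamiltonian -/

/-- The operator `h` has compact resolvent: for some `z`, `h - z` is a bijection from the domain of
`h` onto the whole space, with bounded and compact inverse `R`. -/
def HasCompactResolvent {H : Type*} [NormedAddCommGroup H] [InnerProductSpace ℂ H]
    (h : H →ₗ.[ℂ] H) : Prop :=
  ∃ (z : ℂ) (R : H →L[ℂ] H), IsCompactOperator R ∧
    (∀ x : H, ∃ hx : R x ∈ h.domain, h ⟨R x, hx⟩ - z • R x = x) ∧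
    ∀ y : h.domain, R (h y - z • (y : H)) = y

section Hamiltonian

variable {J : Type*} (e : J → ℝ) (N : ℕ)

/-- The energy `E_α = e_{α₁} + ⋯ + e_{α_N}`. -/
def energy {J : Type*} (e : J → ℝ) {N : ℕ} (α : Fin N → J) : ℝ := ∑ i, e (α i)

/-- The `N`-particle Hamiltonian `H_N = h_1 + ⋯ + h_N`, where `h ψ_j = e_j ψ_j`: the self-adjoint
operator with `H_N Ψ_α = E_α Ψ_α`, on its natural (maximal) domain. -/
def hamiltonian : HN J N →ₗ.[ℂ] HN J N where
  domain :=
    { carrier := {f | Memℓp (fun α => (energy e α : ℂ) * f α) 2}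
      add_mem' := fun {f g} hf hg => by
        have := Memℓp.add hf hg
        refine cast (congrArg (Memℓp · 2) ?_) this
        funext α
        simp [mul_add]
      zero_mem' := by
        have : Memℓp (0 : (Fin N → J) → ℂ) 2 := zero_memℓp
        refine cast (congrArg (Memℓp · 2) ?_) this
        funext α
        simp
      smul_mem' := fun c f hf => by
        have := Memℓp.const_smul hf c
        refine cast (congrArg (Memℓp · 2) ?_) this
        funext α
        simp [mul_left_comm] }
  toFun :=
    { toFun := fun f => ⟨fun α => (energy e α : ℂ) * f.1 α, f.2⟩
      map_add' := fun f g => by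
        ext α
        exact mul_add _ _ _
      map_smul' := fun c f => by ext; simp [mul_left_comm] }

theorem hamiltonian_apply (f : (hamiltonian e N).domain) (α : Fin N → J) :
    hamiltonian e N f α = (energy e α : ℂ) * f.1 α := rfl

/-- On product vectors with factors in the domain of `h`, the operator `hamiltonian e N` is
`h_1 + ⋯ + h_N`. -/
theorem hamiltonian_tprod {J H : Type*} [NormedAddCommGroup H] [InnerProductSpace ℂ H]
    [CompleteSpace H] {h : H →ₗ.[ℂ] H} (hsa : IsSelfAdjoint h) (ψ : HilbertBasis J ℂ H) {e : J → ℝ}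
    (he : ∀ j, ∃ hj : ψ j ∈ h.domain, h ⟨ψ j, hj⟩ = (e j : ℂ) • ψ j) {N : ℕ}
    (φ : Fin N → h.domain) :
    ∃ hφ : tprod ψ (fun i => (φ i : H)) ∈ (hamiltonian e N).domain,
      hamiltonian e N ⟨_, hφ⟩
        = ∑ k, tprod ψ (Function.update (fun i => (φ i : H)) k (h (φ k))) := by
  have hsym : ∀ (j : J) (x : h.domain), ⟪ψ j, h x⟫_ℂ = e j * ⟪ψ j, (x : H)⟫_ℂ := fun j x => by
    obtain ⟨hj, hj2⟩ := he j
    have hfa := LinearPMap.adjoint_isFormalAdjoint (T := h) hsa.dense_domain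
    rw [LinearPMap.isSelfAdjoint_def.1 hsa] at hfa
    have := hfa ⟨ψ j, hj⟩ x
    rw [hj2, inner_smul_left] at this
    simpa using this.symm
  have key : ∀ α : Fin N → J, (energy e α : ℂ) * tprod ψ (fun i => (φ i : H)) α
      = (∑ k, tprod ψ (Function.update (fun i => (φ i : H)) k (h (φ k))) : HN J N) α := fun α => by
    rw [lp.coeFn_sum, Finset.sum_apply, energy, Complex.ofReal_sum, Finset.sum_mul]
    refine Finset.sum_congr rfl fun k _ => ?_
    rw [tprod_apply, tprod_apply, ← Finset.mul_prod_erase _ _ (Finset.mem_univ k),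
      ← Finset.mul_prod_erase _ _ (Finset.mem_univ k), ← mul_assoc]
    congr 1
    · simp [hsym]
    · refine Finset.prod_congr rfl fun i hi => ?_
      rw [Function.update_of_ne (Finset.ne_of_mem_erase hi)]
  refine ⟨?_, ?_⟩
  · change Memℓp (fun α => (energy e α : ℂ) * tprod ψ (fun i => (φ i : H)) α) 2
    rw [funext key]
    exact lp.memℓp _
  · ext α
    rw [hamiltonian_apply]
    exact key α

/-- The energy shell `𝓚_E`: the eigenspace of `H_N` with eigenvalue `E`. -/
def shell (E : ℝ) : Submodule ℂ (HN J N) where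
  carrier := {f | ∃ hf : f ∈ (hamiltonian e N).domain, hamiltonian e N ⟨f, hf⟩ = (E : ℂ) • f}
  add_mem' := by
    rintro f g ⟨hf, hf2⟩ ⟨hg, hg2⟩
    refine ⟨add_mem hf hg, ?_⟩
    rw [smul_add, ← hf2, ← hg2, ← LinearPMap.map_add]
    rfl
  zero_mem' := ⟨zero_mem _, by
    rw [smul_zero]
    exact LinearPMap.map_zero _⟩
  smul_mem' := by
    rintro c f ⟨hf, hf2⟩
    refine ⟨Submodule.smul_mem _ c hf, ?_⟩
    rw [smul_comm, ← hf2, ← LinearPMap.map_smul]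
    rfl

theorem mem_shell_iff (E : ℝ) (f : HN J N) :
    f ∈ shell e N E ↔ ∀ α, (energy e α : ℂ) * f α = (E : ℂ) * f α := by
  constructor
  · rintro ⟨hf, hf2⟩ α
    have := congrArg (fun g : HN J N => g α) hf2
    exact this
  · intro h
    have hf : f ∈ (hamiltonian e N).domain := by
      change Memℓp (fun α => (energy e α : ℂ) * f α) 2
      rw [funext h]
      exact lp.memℓp ((E : ℂ) • f)
    refine ⟨hf, ?_⟩
    ext α
    exact h α

theorem isClosed_shell (E : ℝ) : IsClosed (shell e N E : Set (HN J N)) := by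
  have : (shell e N E : Set (HN J N))
      = ⋂ α, {f : HN J N | (energy e α : ℂ) * f α = (E : ℂ) * f α} := by
    ext f
    simp [mem_shell_iff]
  rw [this]
  refine isClosed_iInter fun α => ?_
  have hc : Continuous fun f : HN J N => f α :=
    (continuous_apply α).comp (lp.uniformContinuous_coe (p := 2)).continuous
  exact isClosed_eq (continuous_const.mul hc) (continuous_const.mul hc)

instance instCompleteSpaceShell (E : ℝ) : CompleteSpace (shell e N E) :=
  (isClosed_shell e N E).completeSpace_coe

/-- `P_E`, the orthogonal projection onto the energy shell `𝓚_E` (it is `0` unless `E` is an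
eigenvalue of `H_N`). -/
def shellProj (E : ℝ) : HN J N →L[ℂ] HN J N := (shell e N E).starProjection

/-- The energy algebra `𝓐_N`: all bounded functions `f(H_N) = ∑_E f(E) P_E` of the Hamiltonian
(the sum converges strongly). -/
def energyAlgebra : Set (HN J N →L[ℂ] HN J N) :=
  {A | ∃ f : ℝ → ℂ, (∃ c : ℝ, ∀ E, ‖f E‖ ≤ c) ∧
    ∀ x, HasSum (fun E : ℝ => f E • shellProj e N E x) (A x)}

end Hamiltonian

/-! ### Collision specifications and the generator -/

/-- A collision specification `(𝓒, U, ν)` for the single-particle energies `(e_j)`. Continuity of `U`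
is with respect to the strong operator topology (so norm continuous `U` are included). -/
structure CollisionSpec {J : Type*} (e : J → ℝ) (C : Type*) [MetricSpace C] [CompactSpace C]
    [MeasurableSpace C] [BorelSpace C] where
  U : C → HN J 2 →L[ℂ] HN J 2
  unitary_U : ∀ σ, U σ ∈ unitary (HN J 2 →L[ℂ] HN J 2)
  continuous_U : ∀ v, Continuous fun σ => U σ v
  injective_U : Function.Injective U
  ν : Measure C
  isProbabilityMeasure : IsProbabilityMeasure ν
  isOpenPosMeasure : ν.IsOpenPosMeasure
  /-- `U(σ)` commutes with `H_2`. -/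
  commutes : ∀ (σ : C) (x : (hamiltonian e 2).domain),
    ∃ hx : U σ x ∈ (hamiltonian e 2).domain, hamiltonian e 2 ⟨U σ x, hx⟩ = U σ (hamiltonian e 2 x)
  exists_one : ∃ σ₀, U σ₀ = 1
  /-- Time reversibility; `τ` is the map `σ ↦ σ'` with `U(σ)^* = U(σ')`. -/
  reversible : ∃ τ : C → C, (∀ σ, star (U σ) = U (τ σ)) ∧ MeasurePreserving τ ν ν
  /-- Exchange symmetry; `τ` is the map `σ ↦ σ'` with `V U(σ) V^* = U(σ')`. -/
  symmetric : ∃ τ : C → C, (∀ σ, swap J * U σ * star (swap J) = U (τ σ)) ∧ MeasurePreserving τ ν ν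

namespace CollisionSpec

variable {J : Type*} {e : J → ℝ} {C : Type*} [MetricSpace C] [CompactSpace C] [MeasurableSpace C]
  [BorelSpace C] (S : CollisionSpec e C)

instance instIsProbabilityMeasure : IsProbabilityMeasure S.ν := S.isProbabilityMeasure

/-- Ergodicity: `{U(σ) : σ ∈ 𝓒}' = 𝓐_2`. -/
def IsErgodic : Prop := Set.centralizer (Set.range S.U) = energyAlgebra e 2

variable {N : ℕ}

/-- `U_{i,j}(σ)` on `𝓗_N`. -/
def pairU (p : Pair N) (σ : C) : HN J N →L[ℂ] HN J N := pairOp p (S.U σ)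

theorem pairU_mem_unitary (p : Pair N) (σ : C) : S.pairU p σ ∈ unitary (HN J N →L[ℂ] HN J N) :=
  amp_mem_unitary _ (S.unitary_U σ)

theorem continuous_conj (p : Pair N) (A : HN J N →L[ℂ] HN J N) (v : HN J N) :
    Continuous fun σ => S.pairU p σ (A (star (S.pairU p σ) v)) :=
  continuous_conj_apply (S.pairU_mem_unitary p)
    (continuous_amp (pairEquiv J p) S.unitary_U S.continuous_U) A v

theorem integrable_conj (p : Pair N) (A : HN J N →L[ℂ] HN J N) (v : HN J N) :
    Integrable (fun σ => S.pairU p σ (A (star (S.pairU p σ) v))) S.ν :=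
  (S.continuous_conj p A v).integrable_of_hasCompactSupport (HasCompactSupport.of_compactSpace _)

/-- `𝒬_{i,j} A = ∫ U_{i,j}(σ) A U_{i,j}(σ)^* dν(σ)`, the integral being taken in the strong operator
topology, i.e. after application to a vector. -/
def pairQ (p : Pair N) (A : HN J N →L[ℂ] HN J N) : HN J N →L[ℂ] HN J N :=
  LinearMap.mkContinuous
    { toFun := fun v => ∫ σ, S.pairU p σ (A (star (S.pairU p σ) v)) ∂S.ν
      map_add' := fun v w => by
        rw [← integral_add (S.integrable_conj p A v) (S.integrable_conj p A w)]
        simp only [map_add]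
      map_smul' := fun c v => by
        rw [RingHom.id_apply, ← integral_smul]
        simp only [map_smul] }
    ‖A‖ (fun v => by
      refine (norm_integral_le_of_norm_le_const (C := ‖A‖ * ‖v‖)
        (Eventually.of_forall fun σ => ?_)).trans (by simp)
      refine (norm_apply_le_of_mem_unitary (S.pairU_mem_unitary p σ) _).trans ?_
      refine (A.le_opNorm _).trans ?_
      gcongr
      exact norm_apply_le_of_mem_unitary (Unitary.star_mem (S.pairU_mem_unitary p σ)) _)

theorem pairQ_apply (p : Pair N) (A : HN J N →L[ℂ] HN J N) (v : HN J N) :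
    S.pairQ p A v = ∫ σ, S.pairU p σ (A (star (S.pairU p σ) v)) ∂S.ν := rfl

/-- `𝒬_N = (N choose 2)⁻¹ ∑_{i<j} 𝒬_{i,j}`. -/
def kacQ (A : HN J N →L[ℂ] HN J N) : HN J N →L[ℂ] HN J N :=
  ((N.choose 2 : ℂ))⁻¹ • ∑ p : Pair N, S.pairQ p A

/-- The quantum Kac generator `ℒ_N = N (𝒬_N - 1)`. -/
def kacGenerator (A : HN J N →L[ℂ] HN J N) : HN J N →L[ℂ] HN J N := (N : ℂ) • (S.kacQ A - A)

/-- The algebra `𝒞_N = {U_{i,j}(σ) : i < j, σ ∈ 𝓒}'`. -/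
def conserved (N : ℕ) : Set (HN J N →L[ℂ] HN J N) :=
  Set.centralizer {W | ∃ (p : Pair N) (σ : C), W = S.pairU p σ}

/-- `P` is a minimal projection of `𝒞_N`. -/
def IsMinimalProjection (P : HN J N →L[ℂ] HN J N) : Prop :=
  P ∈ S.conserved N ∧ IsStarProjection P ∧ P ≠ 0 ∧
    ∀ Q ∈ S.conserved N, IsStarProjection Q → Q ≠ 0 → Q ≤ P → Q = P

end CollisionSpec

/-- A density matrix on `𝓗_N`: a positive trace class operator with trace one. For positive operators
the trace is the sum of the diagonal entries in any orthonormal basis, and trace class means that it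
is finite. -/
def IsDensityMatrix {J H : Type*} [NormedAddCommGroup H] [InnerProductSpace ℂ H]
    (ψ : HilbertBasis J ℂ H) {N : ℕ} (ρ : HN J N →L[ℂ] HN J N) : Prop :=
  ρ.IsPositive ∧ HasSum (fun α : Fin N → J => ⟪basisVec ψ α, ρ (basisVec ψ α)⟫_ℂ) 1

/-- The normalized projection `P / Tr P = P / dim (ran P)`, for `P ≠ 0` of finite rank. -/
def normalizedProj {K : Type*} [NormedAddCommGroup K] [InnerProductSpace ℂ K] (P : K →L[ℂ] K) :
    K →L[ℂ] K :=
  ((Module.finrank ℂ P.range : ℂ))⁻¹ • P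

/-- Adjacency of indices. -/
def Adjacent {J : Type*} (e : J → ℝ) {N : ℕ} (α β : Fin N → J) : Prop :=
  ∃ i j : Fin N, i < j ∧ e (α i) + e (α j) = e (β i) + e (β j) ∧
    ∀ k, k ≠ i → k ≠ j → α k = β k

/-- Equivalence of indices: they are joined by a finite sequence of successively adjacent indices. -/
def Equivalent {J : Type*} (e : J → ℝ) {N : ℕ} : (Fin N → J) → (Fin N → J) → Prop :=
  Relation.ReflTransGen (Adjacent e)

end QKac

end

/-! A collision `U_{i,j}(σ)` conserves the energy of the pair and leaves the other indices alone, so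
it has matrix elements only between adjacent indices. Diagonal operators constant on equivalence
classes are therefore conserved (`mem_conserved_of_diagonal`). Conversely, compressing a conserved
operator to the factors `i, j` gives blocks in `{U(σ)}'`. By ergodicity each block is a function of
the pair energy, which forces the operator to be diagonal and constant along adjacency
(`diagonal_of_mem_conserved`). So `𝒞_N` consists of the bounded functions on the set of classes, and
its minimal projections are the indicators of single classes. Classes are finite because total
energy is constant on them and only finitely many `e_j` lie below any bound.

For the steady states, a density matrix is Hilbert-Schmidt, and conjugation by a unitary preserves
the Hilbert-Schmidt norm. If `ℒ_N ρ = 0`, expanding the square shows that the sum over pairs of `∫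
‖ρ - U_{i,j}(σ) ρ U_{i,j}(σ)^*‖² dν` is zero. By continuity in `σ` and full support of `ν`, `ρ`
commutes with every collision (`mem_conserved_of_kacGenerator_eq_zero`). It is then diagonal and
constant on classes, and grouping its diagonal by classes gives the convex combination. -/

namespace QKac

open MeasureTheory Filter Topology

/-! ### Standard basis, slices and blocks -/

section Delta

variable {X Y Z : Type*}

open Classical in
/-- The standard basis vectors of `ℓ²(Z)`. -/
noncomputable def delta (z : Z) : L2 Z := lp.single 2 z 1

open Classical in
theorem delta_apply (z w : Z) : delta z w = if w = z then 1 else 0 := by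
  rw [delta, lp.single_apply, Pi.single_apply]

theorem delta_apply_self (z : Z) : delta z z = 1 := by simp [delta_apply]

theorem delta_apply_of_ne {z w : Z} (h : w ≠ z) : delta z w = 0 := by simp [delta_apply, h]

open Classical in
theorem inner_delta_left (z : Z) (f : L2 Z) : ⟪delta z, f⟫_ℂ = f z := by
  rw [delta, lp.inner_single_left]; simp

open Classical in
theorem norm_delta (z : Z) : ‖delta z‖ = 1 := by
  rw [delta, lp.norm_single (by norm_num), norm_one]

theorem delta_ne_zero (z : Z) : delta z ≠ 0 := by
  rw [← norm_ne_zero_iff, norm_delta]; norm_num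

theorem orthonormal_delta : Orthonormal ℂ (delta : Z → L2 Z) := by
  classical
  rw [orthonormal_iff_ite]
  intro z w
  rw [inner_delta_left, delta_apply]

theorem hasSum_smul_delta (f : L2 Z) : HasSum (fun z => f z • delta z) f := by
  classical
  have h := lp.hasSum_single (E := fun _ : Z => ℂ) (p := 2) (by norm_num) f
  refine h.congr_fun fun z => ?_
  ext w
  simp only [lp.coeFn_smul, Pi.smul_apply, delta_apply, lp.single_apply, Pi.single_apply]
  simp

/-- Bounded operators agreeing on the standard basis are equal. -/
theorem ext_delta {F : Type*} [NormedAddCommGroup F] [NormedSpace ℂ F] {A B : L2 Z →L[ℂ] F}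
    (h : ∀ z, A (delta z) = B (delta z)) : A = B := by
  ext1 f
  have hA := (hasSum_smul_delta f).mapL A
  have hB := (hasSum_smul_delta f).mapL B
  simp only [map_smul, h] at hA hB
  exact hA.unique hB

theorem basisVec_eq_delta {J H : Type*} [NormedAddCommGroup H] [InnerProductSpace ℂ H]
    (ψ : HilbertBasis J ℂ H) {N : ℕ} (α : Fin N → J) : basisVec ψ α = delta α := by
  ext β
  classical
  by_cases h : β = α <;> simp [basisVec_apply, delta_apply, h]

/-- An operator with all `delta z` as eigenvectors acts by pointwise multiplication. -/
theorem apply_of_diagonal {A : L2 Z →L[ℂ] L2 Z} {a : Z → ℂ}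
    (h : ∀ z, A (delta z) = a z • delta z) (f : L2 Z) (w : Z) : A f w = a w * f w := by
  have hA := ((hasSum_smul_delta f).mapL A).mapL (innerSL ℂ (delta w))
  simp only [map_smul, h, innerSL_apply_apply, inner_delta_left, smul_eq_mul] at hA
  refine hA.unique ?_
  have := hasSum_single (f := fun z => f z * (a z * delta z w)) w fun z hz => by
    rw [delta_apply_of_ne hz.symm]; ring
  simpa [delta_apply_self, mul_comm] using this

theorem star_apply_delta (A : L2 Z →L[ℂ] L2 Z) (z w : Z) :
    (star A) (delta z) w = star (A (delta w) z) := by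
  rw [← inner_delta_left, ContinuousLinearMap.star_eq_adjoint,
    ContinuousLinearMap.adjoint_inner_right, ← inner_conj_symm, inner_delta_left]
  rfl

/-- Taking slices, as a bounded operator. -/
noncomputable def sliceL (E : X × Y ≃ Z) (x : X) : L2 Z →L[ℂ] L2 Y :=
  LinearMap.mkContinuous
    { toFun := fun f => slice E f x
      map_add' := fun f g => slice_add E f g x
      map_smul' := fun c f => slice_smul E c f x }
    1 (fun f => by
      refine le_of_sq_le_sq ?_ (by positivity)
      rw [one_mul, norm_sq_eq_tsum_slice E f]
      exact (summable_slice E f).le_tsum x fun _ _ => sq_nonneg _)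

theorem sliceL_apply (E : X × Y ≃ Z) (x : X) (f : L2 Z) : sliceL E x f = slice E f x := rfl

-- The adjoint of slicing embeds `ℓ²(Y)` as the fibre over `x`, so `sliceL E x ∘L A ∘L adjoint
-- (sliceL E x')` is the `(x, x')` block of `A`.
open ContinuousLinearMap in
theorem adjoint_sliceL_delta (E : X × Y ≃ Z) (x : X) (y : Y) :
    adjoint (sliceL E x) (delta y) = delta (E (x, y)) := by
  refine ext_inner_right ℂ fun f => ?_
  rw [adjoint_inner_left, inner_delta_left, inner_delta_left, sliceL_apply, slice_apply]

theorem sliceL_comp_amp (E : X × Y ≃ Z) (x : X) (A : L2 Y →L[ℂ] L2 Y) :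
    sliceL E x ∘L amp E A = A ∘L sliceL E x := by
  ext1 f
  exact slice_amp E A f x

open ContinuousLinearMap in
theorem amp_comp_adjoint_sliceL (E : X × Y ≃ Z) (x : X) (A : L2 Y →L[ℂ] L2 Y) :
    amp E A ∘L adjoint (sliceL E x) = adjoint (sliceL E x) ∘L A := by
  have h := congrArg adjoint (sliceL_comp_amp E x (star A))
  rw [amp_star, adjoint_comp, adjoint_comp, star_eq_adjoint, star_eq_adjoint, adjoint_adjoint,
    adjoint_adjoint] at h
  exact h

/-- The blocks of an operator commuting with `1 ⊗ W` commute with `W`. -/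
theorem block_mem_centralizer (E : X × Y ≃ Z) {s : Set (L2 Y →L[ℂ] L2 Y)} {A : L2 Z →L[ℂ] L2 Z}
    (hA : ∀ W ∈ s, amp E W * A = A * amp E W) (x x' : X) :
    sliceL E x ∘L A ∘L ContinuousLinearMap.adjoint (sliceL E x') ∈ Set.centralizer s := by
  intro W hW
  ext1 f
  have h1 := congrArg (fun T : L2 Y →L[ℂ] L2 Z => T f) (amp_comp_adjoint_sliceL E x' W)
  have h2 := congrArg (fun T : L2 Z →L[ℂ] L2 Y => T (A (ContinuousLinearMap.adjoint (sliceL E x') f)))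
    (sliceL_comp_amp E x W)
  have h3 := congrArg (fun T : L2 Z →L[ℂ] L2 Z => T (ContinuousLinearMap.adjoint (sliceL E x') f))
    (hA W hW)
  simp only [ContinuousLinearMap.comp_apply, mul_apply_eq_comp] at h1 h2 h3 ⊢
  rw [← h2, h3, h1]

end Delta

/-! ### The conserved algebra in coordinates -/

section Conserved

variable {J : Type*} {e : J → ℝ}

/-- Each basis vector lies in the shell of its own energy and is orthogonal to all others, so one
term of the strong sum survives. -/
theorem energyAlgebra_apply_delta {N : ℕ} {A : HN J N →L[ℂ] HN J N} (hA : A ∈ energyAlgebra e N) :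
    ∃ f : ℝ → ℂ, ∀ α, A (delta α) = f (energy e α) • delta α := by
  obtain ⟨f, -, hf⟩ := hA
  refine ⟨f, fun α => (hf (delta α)).unique ?_⟩
  have h1 : shellProj e N (energy e α) (delta α) = delta α := by
    rw [shellProj, Submodule.starProjection_eq_self_iff, mem_shell_iff]
    intro β
    by_cases h : β = α
    · rw [h]
    · simp [delta_apply_of_ne h]
  have h2 : ∀ E, E ≠ energy e α → f E • shellProj e N E (delta α) = 0 := fun E hE => by
    rw [shellProj, (Submodule.starProjection_apply_eq_zero_iff _).2, smul_zero]
    rw [Submodule.mem_orthogonal']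
    intro u hu
    rw [inner_delta_left]
    have := (mem_shell_iff e N E u).1 hu α
    have h3 : ((energy e α : ℂ) - E) * u α = 0 := by rw [sub_mul, this, sub_self]
    refine (mul_eq_zero.1 h3).resolve_left ?_
    exact sub_ne_zero.2 (by exact_mod_cast hE.symm)
  have := hasSum_single (f := fun E => (f E • shellProj e N E) (delta α)) (energy e α) h2
  simpa [h1] using this

theorem energy_two (β : Fin 2 → J) : energy e β = e (β 0) + e (β 1) := by
  simp [energy, Fin.sum_univ_two]

theorem pairEquiv_symm_snd {N : ℕ} (p : Pair N) (α : Fin N → J) :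
    ((pairEquiv J p).symm α).2 = ![α p.1.1, α p.1.2] := rfl

theorem pairEquiv_symm_fst {N : ℕ} (p : Pair N) (α : Fin N → J) :
    ((pairEquiv J p).symm α).1 = fun k => α k.1 := rfl

/-- Adjacency in the coordinates where `pairOp p` has the form `1 ⊗ A`: same spectators, same pair
energy. -/
theorem adjacent_iff {N : ℕ} (α β : Fin N → J) :
    Adjacent e α β ↔ ∃ p : Pair N, ((pairEquiv J p).symm α).1 = ((pairEquiv J p).symm β).1 ∧
      energy e ((pairEquiv J p).symm α).2 = energy e ((pairEquiv J p).symm β).2 := by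
  simp only [energy_two, pairEquiv_symm_fst, pairEquiv_symm_snd]
  constructor
  · rintro ⟨i, j, hij, h1, h2⟩
    exact ⟨⟨(i, j), hij⟩, funext fun k => h2 k.1 k.2.1 k.2.2, by simpa using h1⟩
  · rintro ⟨⟨⟨i, j⟩, hij⟩, h1, h2⟩
    exact ⟨i, j, hij, by simpa using h2, fun k hi hj => congrFun h1 ⟨k, hi, hj⟩⟩

theorem Adjacent.symm {N : ℕ} {α β : Fin N → J} (h : Adjacent e α β) : Adjacent e β α := by
  obtain ⟨i, j, hij, h1, h2⟩ := h
  exact ⟨i, j, hij, h1.symm, fun k hi hj => (h2 k hi hj).symm⟩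

theorem Equivalent.symm {N : ℕ} {α β : Fin N → J} (h : Equivalent e α β) : Equivalent e β α := by
  induction h with
  | refl => exact .refl
  | tail _ h ih => exact .head h.symm ih

theorem Adjacent.energy_eq {N : ℕ} {α β : Fin N → J} (h : Adjacent e α β) :
    energy e α = energy e β := by
  obtain ⟨i, j, hij, h1, h2⟩ := h
  rw [energy, energy, ← Finset.add_sum_erase _ _ (Finset.mem_univ i),
    ← Finset.add_sum_erase _ _ (Finset.mem_univ i),
    ← Finset.add_sum_erase _ _ (Finset.mem_erase.2 ⟨hij.ne', Finset.mem_univ j⟩),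
    ← Finset.add_sum_erase _ (fun i => e (β i))
      (Finset.mem_erase.2 ⟨hij.ne', Finset.mem_univ j⟩), ← add_assoc, ← add_assoc, h1]
  congr 1
  refine Finset.sum_congr rfl fun k hk => ?_
  simp only [Finset.mem_erase] at hk
  rw [h2 k hk.2.1 hk.1]

theorem Equivalent.energy_eq {N : ℕ} {α β : Fin N → J} (h : Equivalent e α β) :
    energy e α = energy e β := by
  induction h with
  | refl => rfl
  | tail _ h ih => exact ih.trans h.energy_eq

theorem Equivalent.eq_of_adjacent {N : ℕ} {R : Type*} {a : (Fin N → J) → R}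
    (ha : ∀ α β, Adjacent e α β → a α = a β) {α β : Fin N → J} (h : Equivalent e α β) :
    a α = a β := by
  induction h with
  | refl => rfl
  | tail _ h ih => exact ih.trans (ha _ _ h)

variable {C : Type*} [MetricSpace C] [CompactSpace C] [MeasurableSpace C]
  [BorelSpace C] (S : CollisionSpec e C)

/-- Comparing coordinates in `H_2 U δ_β = U H_2 δ_β` shows that the entry is annihilated by `E_{β'}
- E_β`. -/
theorem CollisionSpec.U_delta_apply_eq_zero (σ : C) {β β' : Fin 2 → J}
    (h : energy e β ≠ energy e β') : S.U σ (delta β) β' = 0 := by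
  have hsh : delta β ∈ shell e 2 (energy e β) := by
    rw [mem_shell_iff]
    intro γ
    by_cases h : γ = β
    · rw [h]
    · simp [delta_apply_of_ne h]
  obtain ⟨hd, hd2⟩ := hsh
  obtain ⟨hx, hx2⟩ := S.commutes σ ⟨delta β, hd⟩
  rw [hd2, map_smul] at hx2
  have := congrArg (fun g : HN J 2 => g β') hx2
  simp only [hamiltonian_apply, lp.coeFn_smul, Pi.smul_apply, smul_eq_mul] at this
  have h3 : ((energy e β' : ℂ) - energy e β) * S.U σ (delta β) β' = 0 := by
    rw [sub_mul, this, sub_self]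
  refine (mul_eq_zero.1 h3).resolve_left ?_
  exact sub_ne_zero.2 (by exact_mod_cast h.symm)

theorem slice_delta_of_ne {X Y Z : Type*} (E : X × Y ≃ Z) {z : Z} {x : X}
    (h : x ≠ (E.symm z).1) : slice E (delta z) x = 0 := by
  ext y
  rw [slice_apply, delta_apply_of_ne]
  · rfl
  · rintro rfl
    simp at h

theorem slice_delta {X Y Z : Type*} (E : X × Y ≃ Z) (z : Z) :
    slice E (delta z) (E.symm z).1 = delta (E.symm z).2 := by
  classical
  ext y
  rw [slice_apply, delta_apply, delta_apply]
  refine if_congr ?_ rfl rfl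
  rw [← E.eq_symm_apply, Prod.ext_iff]
  simp

theorem CollisionSpec.adjacent_of_pairU_ne_zero {N : ℕ} (p : Pair N) (σ : C) {α α' : Fin N → J}
    (h : S.pairU p σ (delta α) α' ≠ 0) : Adjacent e α α' := by
  rw [CollisionSpec.pairU, pairOp, amp_apply] at h
  rw [adjacent_iff]
  have h1 : ((pairEquiv J p).symm α').1 = ((pairEquiv J p).symm α).1 := by
    by_contra hne
    rw [slice_delta_of_ne _ hne, map_zero] at h
    exact h rfl
  refine ⟨p, h1.symm, ?_⟩
  rw [h1, slice_delta] at h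
  by_contra hne
  exact h (S.U_delta_apply_eq_zero σ hne)

/-- Diagonal operators constant on classes are conserved. -/
theorem CollisionSpec.mem_conserved_of_diagonal {N : ℕ} {A : HN J N →L[ℂ] HN J N}
    {a : (Fin N → J) → ℂ} (hA : ∀ α, A (delta α) = a α • delta α)
    (ha : ∀ α β, Adjacent e α β → a α = a β) : A ∈ S.conserved N := by
  rintro _ ⟨p, σ, rfl⟩
  refine ext_delta fun α => ?_
  ext α'
  rw [mul_apply_eq_comp, mul_apply_eq_comp, hA, map_smul,
    apply_of_diagonal hA, lp.coeFn_smul, Pi.smul_apply, smul_eq_mul]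
  -- The two products differ only by the factors `a α'` and `a α`, which agree wherever the matrix
  -- element is non-zero.
  by_cases h : S.pairU p σ (delta α) α' = 0
  · rw [h]; simp
  · rw [ha _ _ (S.adjacent_of_pairU_ne_zero p σ h)]

/-- Every factor takes part in some collision; this is where `N ≥ 2` enters the diagonality
argument. -/
theorem exists_pair {N : ℕ} (hN : 2 ≤ N) (k : Fin N) : ∃ p : Pair N, p.1.1 = k ∨ p.1.2 = k := by
  have : Nontrivial (Fin N) := Fin.nontrivial_iff_two_le.2 hN
  obtain ⟨l, hl⟩ := exists_ne k
  rcases lt_or_gt_of_ne hl with h | h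
  · exact ⟨⟨(l, k), h⟩, Or.inr rfl⟩
  · exact ⟨⟨(k, l), h⟩, Or.inl rfl⟩

variable {S}

/-- Conserved operators are diagonal and constant on classes. -/
theorem CollisionSpec.IsErgodic.diagonal_of_mem_conserved (hS : S.IsErgodic) {N : ℕ} (hN : 2 ≤ N)
    {A : HN J N →L[ℂ] HN J N} (hA : A ∈ S.conserved N) :
    (∀ α, A (delta α) = A (delta α) α • delta α) ∧
      ∀ α β, Adjacent e α β → A (delta α) α = A (delta β) β := by
  -- Each block, off-diagonal in the spectators `x, x'` or not, lies in `{U(σ)}' = 𝓐_2`.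
  have key : ∀ (p : Pair N) x x', ∃ f : ℝ → ℂ, ∀ y y',
      A (delta (pairEquiv J p (x', y'))) (pairEquiv J p (x, y))
        = f (energy e y') * delta y' y := fun p x x' => by
    have h1 := block_mem_centralizer (pairEquiv J p) (s := Set.range S.U) (A := A) (by
      rintro _ ⟨σ, rfl⟩
      exact hA _ ⟨p, σ, rfl⟩) x x'
    rw [hS] at h1
    obtain ⟨f, hf⟩ := energyAlgebra_apply_delta h1
    refine ⟨f, fun y y' => ?_⟩
    have := congrArg (fun g : HN J 2 => g y) (hf y')
    simpa only [ContinuousLinearMap.comp_apply, adjoint_sliceL_delta, sliceL_apply, slice_apply,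
      lp.coeFn_smul, Pi.smul_apply, smul_eq_mul] using this
  constructor
  · intro α
    ext β
    rw [lp.coeFn_smul, Pi.smul_apply, smul_eq_mul]
    by_cases h : β = α
    · rw [h, delta_apply_self, mul_one]
    · rw [delta_apply_of_ne h, mul_zero]
      -- Choosing a pair that contains a coordinate where `α` and `β` differ puts the entry off the
      -- diagonal of its block.
      obtain ⟨k, hk⟩ := Function.ne_iff.1 h
      obtain ⟨p, hp⟩ := exists_pair hN k
      obtain ⟨f, hf⟩ := key p ((pairEquiv J p).symm β).1 ((pairEquiv J p).symm α).1
      have := hf ((pairEquiv J p).symm β).2 ((pairEquiv J p).symm α).2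
      rw [Prod.mk.eta, Prod.mk.eta, Equiv.apply_symm_apply, Equiv.apply_symm_apply] at this
      rw [this, delta_apply_of_ne, mul_zero]
      rw [pairEquiv_symm_snd, pairEquiv_symm_snd]
      intro h2
      rcases hp with rfl | rfl
      · exact hk (by simpa using congrFun h2 0)
      · exact hk (by simpa using congrFun h2 1)
  · intro α β h
    obtain ⟨p, h1, h2⟩ := (adjacent_iff α β).1 h
    -- Equal spectators put both diagonal entries in the same block, hence under the same `f`,
    -- evaluated at equal pair energies.
    obtain ⟨f, hf⟩ := key p ((pairEquiv J p).symm α).1 ((pairEquiv J p).symm α).1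
    have ha := hf ((pairEquiv J p).symm α).2 ((pairEquiv J p).symm α).2
    have hb := hf ((pairEquiv J p).symm β).2 ((pairEquiv J p).symm β).2
    rw [h1] at hb
    rw [Prod.mk.eta, Equiv.apply_symm_apply, delta_apply_self] at ha hb
    rw [ha, hb, h2]

end Conserved

/-! ### Finiteness of the equivalence classes -/

section Finiteness

/-- The resolvent acts on `ψ_j` as `(e_j - z)⁻¹`, which is bounded away from zero while `e_j` stays
in a bounded window. Infinitely many such `ψ_j` would have uniformly separated images in a compact
set. -/
theorem HasCompactResolvent.finite_setOf_le {H : Type*} [NormedAddCommGroup H]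
    [InnerProductSpace ℂ H] {h : H →ₗ.[ℂ] H} (hres : HasCompactResolvent h)
    {J : Type*} (ψ : HilbertBasis J ℂ H) {e : J → ℝ}
    (he : ∀ j, ∃ hj : ψ j ∈ h.domain, h ⟨ψ j, hj⟩ = (e j : ℂ) • ψ j)
    (hbdd : BddBelow (Set.range e)) (c : ℝ) : {j | e j ≤ c}.Finite := by
  obtain ⟨z, R, hR, -, hR2⟩ := hres
  obtain ⟨m, hm⟩ := hbdd
  have hψ : ∀ j, ((e j : ℂ) - z) • R (ψ j) = ψ j := fun j => by
    obtain ⟨hj, hj2⟩ := he j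
    have := hR2 ⟨ψ j, hj⟩
    rw [hj2, ← sub_smul, map_smul] at this
    exact this
  have hne : ∀ j, (e j : ℂ) - z ≠ 0 := fun j h0 => by
    have := hψ j
    rw [h0, zero_smul] at this
    have h1 := ψ.orthonormal.1 j
    rw [← this, norm_zero] at h1
    exact zero_ne_one h1
  -- Pairing with `ψ i` removes the `ψ j` contribution; Cauchy-Schwarz gives the bound.
  have hsep : ∀ i j, i ≠ j → 1 ≤ ‖(e i : ℂ) - z‖ * ‖R (ψ i) - R (ψ j)‖ := fun i j hij => by
    have hR' : ∀ k, R (ψ k) = ((e k : ℂ) - z)⁻¹ • ψ k := fun k => by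
      rw [eq_inv_smul_iff₀ (hne k), hψ]
    have h1 : ⟪ψ i, ((e i : ℂ) - z) • (R (ψ i) - R (ψ j))⟫_ℂ = 1 := by
      rw [smul_sub, hψ, hR' j, inner_sub_right, inner_smul_right, inner_smul_right,
        ψ.orthonormal.2 hij, inner_self_eq_norm_sq_to_K, ψ.orthonormal.1 i]
      simp
    have h2 := norm_inner_le_norm (𝕜 := ℂ) (ψ i) (((e i : ℂ) - z) • (R (ψ i) - R (ψ j)))
    rw [h1, ψ.orthonormal.1 i, norm_smul] at h2
    simpa using h2
  by_contra hinf
  -- The open ball of radius 2 contains all unit vectors.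
  obtain ⟨K, hK, hRK⟩ := IsCompactOperator.image_ball_subset_compact (f := (R : H →ₗ[ℂ] H)) hR 2
  obtain ⟨g, hg⟩ : ∃ g : ℕ → {j | e j ≤ c}, Function.Injective g := by
    have := Set.infinite_coe_iff.2 hinf
    exact ⟨Infinite.natEmbedding _, (Infinite.natEmbedding _).injective⟩
  have hmem : ∀ n, R (ψ (g n)) ∈ K := fun n => hRK ⟨ψ (g n), by
    rw [mem_ball_zero_iff, ψ.orthonormal.1]
    norm_num, rfl⟩
  obtain ⟨a, -, φ, hφ, hlim⟩ := hK.tendsto_subseq hmem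
  -- A bound for `|e_j - z|` on the window `[m, c]`; the `+ 1` keeps it positive, and the separation
  -- is then at least `M⁻¹`.
  set M : ℝ := |m| + |c| + ‖z‖ + 1 with hM
  have hMpos : 0 < M := by positivity
  have hbound : ∀ n, ‖(e (g n) : ℂ) - z‖ ≤ M := fun n => by
    have h1 : m ≤ e (g n) := hm ⟨_, rfl⟩
    have h2 : e (g n) ≤ c := (g n).2
    have h3 : |e (g n)| ≤ |m| + |c| := by
      rw [abs_le]
      constructor
      · linarith [neg_abs_le m, abs_nonneg c]
      · linarith [le_abs_self c, abs_nonneg m]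
    calc ‖(e (g n) : ℂ) - z‖ ≤ ‖(e (g n) : ℂ)‖ + ‖z‖ := norm_sub_le _ _
      _ = |e (g n)| + ‖z‖ := by rw [Complex.norm_real, Real.norm_eq_abs]
      _ ≤ M := by linarith
  obtain ⟨n, hn⟩ := Metric.cauchySeq_iff'.1 hlim.cauchySeq M⁻¹ (by positivity)
  have h1 := hn (n + 1) (Nat.le_succ n)
  have h2 : (g (φ (n + 1)) : J) ≠ g (φ n) := fun h =>
    absurd (hφ.injective (hg (Subtype.ext h))) (Nat.succ_ne_self n)
  have h3 := hsep _ _ h2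
  rw [dist_eq_norm] at h1
  have h4 : ‖(e (g (φ (n + 1))) : ℂ) - z‖ * ‖R (ψ (g (φ (n + 1)))) - R (ψ (g (φ n)))‖ < 1 := by
    calc _ ≤ M * ‖R (ψ (g (φ (n + 1)))) - R (ψ (g (φ n)))‖ := by
          gcongr
          exact hbound _
      _ < M * M⁻¹ := by
          gcongr
          exact h1
      _ = 1 := mul_inv_cancel₀ hMpos.ne'
  exact absurd h3 (not_le.2 h4)

theorem finite_setOf_equivalent {J : Type*} {e : J → ℝ} (hbdd : BddBelow (Set.range e))
    (hfin : ∀ c, {j | e j ≤ c}.Finite) {N : ℕ} (α₀ : Fin N → J) :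
    {α | Equivalent e α₀ α}.Finite := by
  obtain ⟨m, hm⟩ := hbdd
  have hm : ∀ j, m ≤ e j := fun j => hm ⟨j, rfl⟩
  -- The other `N - 1` energies are at least `m`, so each `e (α i)` is at most `E - (N - 1) m`.
  refine (Set.Finite.pi' fun _ : Fin N => hfin (energy e α₀ - N * m + m)).subset fun α hα i => ?_
  have hE : energy e α₀ = energy e α := Equivalent.energy_eq hα
  change e (α i) ≤ _
  have h1 : e (α i) - m ≤ ∑ k, (e (α k) - m) :=
    Finset.single_le_sum (f := fun k => e (α k) - m) (fun k _ => by linarith [hm (α k)])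
      (Finset.mem_univ i)
  rw [Finset.sum_sub_distrib] at h1
  simp only [Finset.sum_const, Finset.card_univ, Fintype.card_fin, nsmul_eq_mul] at h1
  rw [hE, energy]
  linarith

end Finiteness

/-! ### Coordinate projections -/

section Indicator

variable {Z : Type*}

/-- `A` is multiplication by the indicator function of `s`. -/
def ActsAsIndicator (A : L2 Z →L[ℂ] L2 Z) (s : Set Z) : Prop :=
  ∀ z, A (delta z) = s.indicator (1 : Z → ℂ) z • delta z

variable {A B : L2 Z →L[ℂ] L2 Z} {s t : Set Z}

theorem ActsAsIndicator.apply_mem (hA : ActsAsIndicator A s) {z : Z} (hz : z ∈ s) :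
    A (delta z) = delta z := by
  rw [hA, Set.indicator_of_mem hz, Pi.one_apply, one_smul]

theorem ActsAsIndicator.apply_notMem (hA : ActsAsIndicator A s) {z : Z} (hz : z ∉ s) :
    A (delta z) = 0 := by
  rw [hA, Set.indicator_of_notMem hz, zero_smul]

theorem ActsAsIndicator.unique (hA : ActsAsIndicator A s) (hB : ActsAsIndicator B s) : A = B :=
  ext_delta fun z => by rw [hA, hB]

theorem ActsAsIndicator.mem_iff (hA : ActsAsIndicator A s) {z : Z} :
    z ∈ s ↔ A (delta z) ≠ 0 := by
  by_cases hz : z ∈ s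
  · simp [hz, hA.apply_mem hz, delta_ne_zero]
  · simp [hz, hA.apply_notMem hz]

theorem ActsAsIndicator.ne_zero_iff (hA : ActsAsIndicator A s) : A ≠ 0 ↔ s.Nonempty := by
  constructor
  · contrapose!
    rintro rfl
    exact ext_delta fun z => by rw [hA.apply_notMem (Set.notMem_empty z)]; simp
  · rintro ⟨z, hz⟩ h0
    rw [hA.mem_iff, h0] at hz
    exact hz rfl

theorem ActsAsIndicator.isStarProjection (hA : ActsAsIndicator A s) : IsStarProjection A := by
  constructor
  · refine ext_delta fun z => ?_
    rw [mul_apply_eq_comp]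
    by_cases hz : z ∈ s
    · rw [hA.apply_mem hz, hA.apply_mem hz]
    · rw [hA.apply_notMem hz, map_zero]
  · refine ext_delta fun z => ?_
    ext w
    rw [star_apply_delta, hA, hA]
    simp only [lp.coeFn_smul, Pi.smul_apply, smul_eq_mul]
    by_cases h : w = z
    · rw [h, delta_apply_self, mul_one]
      by_cases hz : z ∈ s <;> simp [hz]
    · rw [delta_apply_of_ne h, delta_apply_of_ne (Ne.symm h)]
      simp

/-- Idempotence gives `a z * a z = a z`, so the diagonal takes only the values 0 and 1. -/
theorem IsStarProjection.exists_actsAsIndicator (hA : IsStarProjection A) {a : Z → ℂ}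
    (ha : ∀ z, A (delta z) = a z • delta z) : ActsAsIndicator A {z | a z = 1} := by
  intro z
  have h1 := congrArg (fun T : L2 Z →L[ℂ] L2 Z => T (delta z) z) hA.isIdempotentElem.eq
  simp only [mul_apply_eq_comp, ha, map_smul, lp.coeFn_smul, Pi.smul_apply, smul_eq_mul,
    delta_apply_self, mul_one] at h1
  rw [ha]
  by_cases hz : a z = 1
  · rw [Set.indicator_of_mem (by exact hz), hz]
    rfl
  · rw [Set.indicator_of_notMem (by exact hz)]
    have h2 : a z * (a z - 1) = 0 := by rw [mul_sub, h1, mul_one, sub_self]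
    rw [(mul_eq_zero.1 h2).resolve_right (sub_ne_zero.2 hz)]

theorem ActsAsIndicator.le_iff (hA : ActsAsIndicator A s) (hB : ActsAsIndicator B t) :
    A ≤ B ↔ s ⊆ t := by
  rw [ContinuousLinearMap.le_def]
  constructor
  · intro h z hz
    by_contra hzt
    -- At a point of `s \ t` the diagonal entry of `B - A` would be `-1`.
    have h1 := h.re_inner_nonneg_right (delta z)
    rw [_root_.sub_apply, hA.apply_mem hz, hB.apply_notMem hzt, inner_delta_left] at h1
    simp [delta_apply_self] at h1
    linarith
  · intro hst
    have : ActsAsIndicator (B - A) (t \ s) := fun z => by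
      rw [_root_.sub_apply, hA, hB, ← sub_smul]
      by_cases hs : z ∈ s
      · simp [hs, hst hs]
      · by_cases ht : z ∈ t <;> simp [hs, ht]
    exact ContinuousLinearMap.IsPositive.of_isStarProjection this.isStarProjection

/-- Finiteness of `s` is essential: for infinite `s` the `finsum` takes its default value 0. -/
theorem actsAsIndicator_finsum (hs : s.Finite) :
    ActsAsIndicator (∑ᶠ z ∈ s, InnerProductSpace.rankOne ℂ (delta z) (delta z)) s := by
  classical
  intro z
  rw [finsum_mem_eq_finite_toFinset_sum _ hs, sum_apply]
  simp only [InnerProductSpace.rankOne_apply, inner_delta_left, delta_apply]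
  by_cases hz : z ∈ s
  · rw [Finset.sum_eq_single z]
    · simp [hz]
    · intro b _ hb
      simp [hb]
    · simp [hz]
  · rw [Finset.sum_eq_zero]
    · simp [hz]
    · intro b hb
      have : b ≠ z := by
        rintro rfl
        exact hz (by simpa using hb)
      simp [this]

theorem ActsAsIndicator.range_eq (hA : ActsAsIndicator A s) (hs : s.Finite) :
    A.range = Submodule.span ℂ (Set.range fun z : s => (delta z.1 : L2 Z)) := by
  apply le_antisymm
  · rintro _ ⟨f, rfl⟩
    rw [hA.unique (actsAsIndicator_finsum hs), finsum_mem_eq_finite_toFinset_sum _ hs]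
    simp only [ContinuousLinearMap.coe_coe, sum_apply,
      InnerProductSpace.rankOne_apply]
    refine Submodule.sum_mem _ fun z hz => Submodule.smul_mem _ _ (Submodule.subset_span ?_)
    exact ⟨⟨z, by simpa using hz⟩, rfl⟩
  · rw [Submodule.span_le]
    rintro _ ⟨z, rfl⟩
    exact ⟨delta z.1, hA.apply_mem z.2⟩

theorem ActsAsIndicator.finiteDimensional_range (hA : ActsAsIndicator A s) (hs : s.Finite) :
    FiniteDimensional ℂ A.range := by
  have := hs.to_subtype
  rw [hA.range_eq hs]
  exact FiniteDimensional.span_of_finite ℂ (Set.finite_range _)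

theorem ActsAsIndicator.finrank_range (hA : ActsAsIndicator A s) (hs : s.Finite) :
    Module.finrank ℂ A.range = Nat.card s := by
  have := hs.fintype
  rw [hA.range_eq hs, Nat.card_eq_fintype_card]
  exact finrank_span_eq_card
    (orthonormal_delta.linearIndependent.comp (fun z : s => z.1) Subtype.val_injective)

-- The diagonal is `1 / |s|` on `s` and zero elsewhere, and the rank of the projection is `|s|`.
open scoped ComplexOrder in
theorem isDensityMatrix_normalizedProj {J H : Type*} [NormedAddCommGroup H]
    [InnerProductSpace ℂ H] (ψ : HilbertBasis J ℂ H) {N : ℕ} {P : HN J N →L[ℂ] HN J N}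
    {s : Set (Fin N → J)} (hP : ActsAsIndicator P s) (hs : s.Finite) (hne : s.Nonempty) :
    IsDensityMatrix ψ (normalizedProj P) := by
  refine ⟨?_, ?_⟩
  · refine ContinuousLinearMap.IsPositive.smul_of_nonneg
      (ContinuousLinearMap.IsPositive.of_isStarProjection hP.isStarProjection) ?_
    rw [inv_nonneg]
    exact Nat.cast_nonneg _
  · simp only [basisVec_eq_delta, normalizedProj, hP.finrank_range hs]
    have h1 : ∀ α : Fin N → J, ⟪delta α, ((Nat.card s : ℂ)⁻¹ • P) (delta α)⟫_ℂ
        = s.indicator (fun _ => (Nat.card s : ℂ)⁻¹) α := fun α => by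
      rw [_root_.smul_apply, inner_smul_right, hP, inner_smul_right, inner_delta_left,
        delta_apply_self]
      by_cases h : α ∈ s <;> simp [h]
    simp only [h1]
    rw [← hasSum_subtype_iff_indicator]
    have := hs.fintype
    have h2 := hasSum_fintype (fun _ : s => (Nat.card s : ℂ)⁻¹)
    have h3 : ∑ _x : s, (Nat.card s : ℂ)⁻¹ = 1 := by
      have : Nonempty s := hne.to_subtype
      rw [Finset.sum_const, Finset.card_univ, nsmul_eq_mul, ← Nat.card_eq_fintype_card]
      exact mul_inv_cancel₀ (Nat.cast_ne_zero.2 Nat.card_pos.ne')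
    rw [h3] at h2
    exact h2

end Indicator

/-! ### Minimal projections -/

section Minimal

variable {J : Type*} {e : J → ℝ} {C : Type*} [MetricSpace C] [CompactSpace C] [MeasurableSpace C]
  [BorelSpace C] {S : CollisionSpec e C} {N : ℕ}

theorem indicator_eq_of_adjacent {α₀ : Fin N → J} (α β : Fin N → J) (h : Adjacent e α β) :
    {α | Equivalent e α₀ α}.indicator (1 : (Fin N → J) → ℂ) α
      = {α | Equivalent e α₀ α}.indicator (1 : (Fin N → J) → ℂ) β := by
  have : Equivalent e α₀ α ↔ Equivalent e α₀ β := ⟨fun h' => h'.tail h, fun h' => h'.tail h.symm⟩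
  by_cases h' : Equivalent e α₀ α
  · rw [Set.indicator_of_mem (by exact h'), Set.indicator_of_mem (by exact this.1 h')]
    rfl
  · rw [Set.indicator_of_notMem (by exact h'), Set.indicator_of_notMem (by exact mt this.2 h')]

/-- The minimal projections are the projections onto the equivalence classes. -/
theorem CollisionSpec.IsErgodic.isMinimalProjection_iff (hS : S.IsErgodic) (hN : 2 ≤ N)
    (hfin : ∀ α₀ : Fin N → J, {α | Equivalent e α₀ α}.Finite) (P : HN J N →L[ℂ] HN J N) :
    S.IsMinimalProjection P ↔ ∃ α₀, ActsAsIndicator P {α | Equivalent e α₀ α} := by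
  -- Conserved projections are indicators of unions of classes.
  have key : ∀ Q ∈ S.conserved N, IsStarProjection Q → ∃ s : Set (Fin N → J),
      ActsAsIndicator Q s ∧ ∀ α₀ ∈ s, {α | Equivalent e α₀ α} ⊆ s := fun Q hQ hQ2 => by
    obtain ⟨h1, h2⟩ := hS.diagonal_of_mem_conserved hN hQ
    refine ⟨_, IsStarProjection.exists_actsAsIndicator hQ2 h1, fun α₀ h α hα => ?_⟩
    have := Equivalent.eq_of_adjacent h2 hα
    exact this.symm.trans h
  constructor
  · rintro ⟨hP, hP2, hP3, hmin⟩
    obtain ⟨s, hs, hs2⟩ := key P hP hP2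
    obtain ⟨α₀, hα₀⟩ := hs.ne_zero_iff.1 hP3
    have hQ := actsAsIndicator_finsum (hfin α₀)
    refine ⟨α₀, ?_⟩
    -- Minimality is tested against the projection onto one class contained in `s`.
    rw [← hmin _ (S.mem_conserved_of_diagonal hQ indicator_eq_of_adjacent) hQ.isStarProjection
      (hQ.ne_zero_iff.2 ⟨α₀, .refl⟩) ((hQ.le_iff hs).2 (hs2 α₀ hα₀))]
    exact hQ
  · rintro ⟨α₀, hP⟩
    refine ⟨S.mem_conserved_of_diagonal hP indicator_eq_of_adjacent, hP.isStarProjection,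
      hP.ne_zero_iff.2 ⟨α₀, .refl⟩, fun Q hQ hQ2 hQ3 hle => ?_⟩
    obtain ⟨s, hs, hs2⟩ := key Q hQ hQ2
    obtain ⟨α, hα⟩ := hs.ne_zero_iff.1 hQ3
    have h1 : s ⊆ {α | Equivalent e α₀ α} := (hs.le_iff hP).1 hle
    have h2 : {α | Equivalent e α₀ α} ⊆ s := fun β hβ =>
      hs2 α hα ((Equivalent.symm (h1 hα)).trans hβ)
    rw [h1.antisymm h2] at hs
    exact hs.unique hP

end Minimal

/-! ### Hilbert-Schmidt norms -/

section HilbertSchmidt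

/-- Write `T = B^* B`; then `‖T v‖² ≤ ‖B^*‖² ‖B v‖²` and `‖B v‖² = ⟪v, T v⟫`. Thus a positive
operator of finite trace is Hilbert-Schmidt. -/
theorem norm_sq_apply_le_of_isPositive {H : Type*} [NormedAddCommGroup H] [InnerProductSpace ℂ H]
    [CompleteSpace H] {T : H →L[ℂ] H} (hT : T.IsPositive) :
    ∃ c : ℝ, ∀ v, ‖T v‖ ^ 2 ≤ c * (⟪v, T v⟫_ℂ).re := by
  obtain ⟨B, hB⟩ := CStarAlgebra.nonneg_iff_eq_star_mul_self.1
    ((ContinuousLinearMap.nonneg_iff_isPositive T).2 hT)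
  refine ⟨‖star B‖ ^ 2, fun v => ?_⟩
  have h1 : (⟪v, T v⟫_ℂ).re = ‖B v‖ ^ 2 := by
    rw [hB, mul_apply_eq_comp, ContinuousLinearMap.star_eq_adjoint,
      ContinuousLinearMap.adjoint_inner_right, inner_self_eq_norm_sq_to_K]
    norm_cast
  rw [h1, hB, mul_apply_eq_comp, ← mul_pow]
  gcongr
  exact (star B).le_opNorm _

variable {Z : Type*}

theorem enorm_sq_eq_tsum (f : L2 Z) : ‖f‖ₑ ^ 2 = ∑' z, ‖f z‖ₑ ^ 2 := by
  rw [← ofReal_norm, ← ENNReal.ofReal_pow (norm_nonneg _), L2.norm_sq,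
    ENNReal.ofReal_tsum_of_nonneg (fun _ => sq_nonneg _) (L2.summable_sq f)]
  refine tsum_congr fun z => ?_
  rw [ENNReal.ofReal_pow (norm_nonneg _), ofReal_norm]

/-- The Hilbert-Schmidt norms of an operator and of its adjoint agree. -/
theorem tsum_enorm_sq_star (A : L2 Z →L[ℂ] L2 Z) :
    ∑' z, ‖(star A) (delta z)‖ₑ ^ 2 = ∑' z, ‖A (delta z)‖ₑ ^ 2 := by
  simp_rw [enorm_sq_eq_tsum, star_apply_delta]
  rw [ENNReal.tsum_comm]
  refine tsum_congr fun z => tsum_congr fun w => ?_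
  rw [← ofReal_norm, norm_star, ofReal_norm]

theorem tsum_enorm_sq_unitary_mul {W : L2 Z →L[ℂ] L2 Z} (hW : W ∈ unitary (L2 Z →L[ℂ] L2 Z))
    (A : L2 Z →L[ℂ] L2 Z) :
    ∑' z, ‖(W * A) (delta z)‖ₑ ^ 2 = ∑' z, ‖A (delta z)‖ₑ ^ 2 := by
  refine tsum_congr fun z => ?_
  rw [mul_apply_eq_comp, ← ofReal_norm, ContinuousLinearMap.norm_map_of_mem_unitary hW,
    ofReal_norm]

/-- The Hilbert-Schmidt norm is invariant under conjugation by unitaries. -/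
theorem tsum_enorm_sq_conj {W : L2 Z →L[ℂ] L2 Z} (hW : W ∈ unitary (L2 Z →L[ℂ] L2 Z))
    (A : L2 Z →L[ℂ] L2 Z) :
    ∑' z, ‖W (A (star W (delta z)))‖ₑ ^ 2 = ∑' z, ‖A (delta z)‖ₑ ^ 2 := by
  have h : ∀ z : Z, W (A (star W (delta z))) = (W * (A * star W)) (delta z) := fun z => rfl
  simp_rw [h]
  -- The left factor preserves the norm of every column; the right factor becomes a left one after
  -- taking adjoints.
  rw [tsum_enorm_sq_unitary_mul hW, ← tsum_enorm_sq_star, star_mul, star_star,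
    tsum_enorm_sq_unitary_mul hW, tsum_enorm_sq_star]

/-- Passing through `[0, ∞]` avoids proving summability for the conjugated operator. Finite sums
suffice and can be interchanged with the integral over `σ`. -/
theorem sum_norm_sq_conj_le {W : L2 Z →L[ℂ] L2 Z} (hW : W ∈ unitary (L2 Z →L[ℂ] L2 Z))
    {A : L2 Z →L[ℂ] L2 Z} (hA : Summable fun z => ‖A (delta z)‖ ^ 2) (F : Finset Z) :
    ∑ z ∈ F, ‖W (A (star W (delta z)))‖ ^ 2 ≤ ∑' z, ‖A (delta z)‖ ^ 2 := by
  have h1 : ∀ x : L2 Z, ENNReal.ofReal (‖x‖ ^ 2) = ‖x‖ₑ ^ 2 := fun x => by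
    rw [ENNReal.ofReal_pow (norm_nonneg _), ofReal_norm]
  rw [← ENNReal.ofReal_le_ofReal_iff (tsum_nonneg fun _ => sq_nonneg _),
    ENNReal.ofReal_sum_of_nonneg (fun _ _ => sq_nonneg _),
    ENNReal.ofReal_tsum_of_nonneg (fun _ => sq_nonneg _) hA]
  simp_rw [h1]
  rw [← tsum_enorm_sq_conj hW]
  exact ENNReal.sum_le_tsum F

end HilbertSchmidt

/-! ### The kernel of the generator -/

section Fixed

variable {J : Type*} {e : J → ℝ} {C : Type*} [MetricSpace C] [CompactSpace C] [MeasurableSpace C]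
  [BorelSpace C] (S : CollisionSpec e C) {N : ℕ}

theorem card_pair (N : ℕ) : Fintype.card (Pair N) = N.choose 2 := by
  rw [Fintype.card_subtype, Fintype.card_product_filter_lt, Fintype.card_fin]

theorem CollisionSpec.kacGenerator_eq_zero_iff (hN : 2 ≤ N) (A : HN J N →L[ℂ] HN J N) :
    S.kacGenerator A = 0 ↔ ∑ p : Pair N, S.pairQ p A = (N.choose 2 : ℂ) • A := by
  have h1 : (N : ℂ) ≠ 0 := Nat.cast_ne_zero.2 (by omega)
  have h2 : (N.choose 2 : ℂ) ≠ 0 := Nat.cast_ne_zero.2 (Nat.choose_pos hN).ne'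
  rw [CollisionSpec.kacGenerator, smul_eq_zero_iff_right h1, sub_eq_zero, CollisionSpec.kacQ,
    inv_smul_eq_iff₀ h2]

/-- Every conjugate of a conserved `A` is `A` itself, and `ν` has mass one. -/
theorem CollisionSpec.kacGenerator_eq_zero_of_mem_conserved (hN : 2 ≤ N)
    {A : HN J N →L[ℂ] HN J N} (hA : A ∈ S.conserved N) : S.kacGenerator A = 0 := by
  rw [S.kacGenerator_eq_zero_iff hN]
  have h : ∀ p : Pair N, S.pairQ p A = A := fun p => by
    ext1 v
    rw [S.pairQ_apply]
    have h1 : ∀ σ, S.pairU p σ (A (star (S.pairU p σ) v)) = A v := fun σ => by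
      have h2 := congrArg (fun T : HN J N →L[ℂ] HN J N => T (star (S.pairU p σ) v))
        (hA _ ⟨p, σ, rfl⟩)
      have h3 := congrArg (fun T : HN J N →L[ℂ] HN J N => T v)
        (Unitary.mem_iff.1 (S.pairU_mem_unitary p σ)).2
      simp only [mul_apply_eq_comp, one_apply_eq_self] at h2 h3
      rw [h2, h3]
    simp [h1]
  simp only [h, Finset.sum_const, Finset.card_univ, card_pair]
  norm_cast

/-- Expanding the square makes the cross term linear in the conjugated operator, so its average is
expressed through `pairQ`. -/
theorem CollisionSpec.integral_norm_sub_conj_sq (p : Pair N) (A : HN J N →L[ℂ] HN J N)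
    (v : HN J N) :
    ∫ σ, ‖A v - S.pairU p σ (A (star (S.pairU p σ) v))‖ ^ 2 ∂S.ν
      = ‖A v‖ ^ 2 - 2 * (⟪A v, S.pairQ p A v⟫_ℂ).re
        + ∫ σ, ‖S.pairU p σ (A (star (S.pairU p σ) v))‖ ^ 2 ∂S.ν := by
  have hc := S.continuous_conj p A v
  have hint : ∀ {f : C → ℝ}, Continuous f → Integrable f S.ν := fun hf =>
    hf.integrable_of_hasCompactSupport (HasCompactSupport.of_compactSpace _)
  have hi : Integrable (fun σ => ⟪A v, S.pairU p σ (A (star (S.pairU p σ) v))⟫_ℂ) S.ν :=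
    (S.integrable_conj p A v).const_inner _
  have h1 : ∫ σ, (⟪A v, S.pairU p σ (A (star (S.pairU p σ) v))⟫_ℂ).re ∂S.ν
      = (⟪A v, S.pairQ p A v⟫_ℂ).re := by
    rw [S.pairQ_apply, ← integral_inner (S.integrable_conj p A v)]
    exact integral_re hi
  have h2 : ∀ σ, ‖A v - S.pairU p σ (A (star (S.pairU p σ) v))‖ ^ 2
      = ‖A v‖ ^ 2 - 2 * (⟪A v, S.pairU p σ (A (star (S.pairU p σ) v))⟫_ℂ).re
        + ‖S.pairU p σ (A (star (S.pairU p σ) v))‖ ^ 2 := fun σ =>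
    norm_sub_sq (𝕜 := ℂ) _ _
  have h3 : Continuous fun σ => (⟪A v, S.pairU p σ (A (star (S.pairU p σ) v))⟫_ℂ).re :=
    Complex.continuous_re.comp (continuous_const.inner hc)
  simp_rw [h2]
  have h4 : Continuous fun σ => 2 * (⟪A v, S.pairU p σ (A (star (S.pairU p σ) v))⟫_ℂ).re :=
    continuous_const.mul h3
  have h5 : Continuous fun σ => ‖S.pairU p σ (A (star (S.pairU p σ) v))‖ ^ 2 := hc.norm.pow 2
  have h6 : Continuous fun σ =>
      ‖A v‖ ^ 2 - 2 * (⟪A v, S.pairU p σ (A (star (S.pairU p σ) v))⟫_ℂ).re :=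
    continuous_const.sub h4
  rw [integral_add (hint h6) (hint h5), integral_sub (hint continuous_const) (hint h4),
    integral_const_mul, h1]
  simp

/-- A Hilbert-Schmidt operator annihilated by the Kac generator is conserved. -/
theorem CollisionSpec.mem_conserved_of_kacGenerator_eq_zero (hN : 2 ≤ N)
    {A : HN J N →L[ℂ] HN J N} (hA : Summable fun α => ‖A (delta α)‖ ^ 2)
    (h0 : S.kacGenerator A = 0) : A ∈ S.conserved N := by
  rw [S.kacGenerator_eq_zero_iff hN] at h0
  have hM : (0 : ℝ) < N.choose 2 := Nat.cast_pos.2 (Nat.choose_pos hN)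
  -- The contribution of the column `α` to the averaged squared Hilbert-Schmidt distance between `A`
  -- and its conjugates.
  set D : (Fin N → J) → ℝ := fun α =>
    ∑ p : Pair N, ∫ σ, ‖A (delta α) - S.pairU p σ (A (star (S.pairU p σ) (delta α)))‖ ^ 2 ∂S.ν
    with hD
  have hD0 : ∀ α, 0 ≤ D α := fun α =>
    Finset.sum_nonneg fun p _ => integral_nonneg fun σ => sq_nonneg _
  -- By `h0` the cross terms total `-2 * N.choose 2 * ‖A (delta α)‖ ^ 2`, twice the size of the
  -- first term.
  have hDeq : ∀ α, D α + N.choose 2 * ‖A (delta α)‖ ^ 2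
      = ∑ p : Pair N, ∫ σ, ‖S.pairU p σ (A (star (S.pairU p σ) (delta α)))‖ ^ 2 ∂S.ν := fun α => by
    have h1 : ∑ p : Pair N, (⟪A (delta α), S.pairQ p A (delta α)⟫_ℂ).re
        = N.choose 2 * ‖A (delta α)‖ ^ 2 := by
      have := congrArg (fun T : HN J N →L[ℂ] HN J N => (⟪A (delta α), T (delta α)⟫_ℂ).re) h0
      simp only [sum_apply, inner_sum, Complex.re_sum, _root_.smul_apply, inner_smul_right,
        inner_self_eq_norm_sq_to_K] at this
      rw [this]
      have h2 : (N.choose 2 : ℂ) * (‖A (delta α)‖ : ℂ) ^ 2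
          = ((N.choose 2 * ‖A (delta α)‖ ^ 2 : ℝ) : ℂ) := by push_cast; rfl
      exact (congrArg Complex.re h2).trans (Complex.ofReal_re _)
    rw [hD]
    simp only [S.integral_norm_sub_conj_sq]
    rw [Finset.sum_add_distrib, Finset.sum_sub_distrib, ← Finset.mul_sum, h1, Finset.sum_const,
      Finset.card_univ, card_pair, nsmul_eq_mul]
    ring
  have hint : ∀ (p : Pair N) (α : Fin N → J), Integrable
      (fun σ => ‖S.pairU p σ (A (star (S.pairU p σ) (delta α)))‖ ^ 2) S.ν := fun p α =>
    ((S.continuous_conj p A (delta α)).norm.pow 2).integrable_of_hasCompactSupport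
      (HasCompactSupport.of_compactSpace _)
  have hF : ∀ F : Finset (Fin N → J), ∑ α ∈ F, (D α + N.choose 2 * ‖A (delta α)‖ ^ 2)
      ≤ N.choose 2 * ∑' α, ‖A (delta α)‖ ^ 2 := fun F => by
    simp_rw [hDeq]
    rw [Finset.sum_comm, ← card_pair, ← Finset.card_univ, ← nsmul_eq_mul]
    refine Finset.sum_le_card_nsmul _ _ _ fun p _ => ?_
    rw [← integral_finsetSum _ fun α _ => hint p α]
    refine (integral_mono (integrable_finsetSum _ fun α _ => hint p α)
      (integrable_const (∑' α, ‖A (delta α)‖ ^ 2)) fun σ =>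
        sum_norm_sq_conj_le (S.pairU_mem_unitary p σ) hA F).trans ?_
    simp
  have hDz : ∀ α, D α = 0 := fun α => by
    classical
    refine le_antisymm ?_ (hD0 α)
    -- By `hF`, all partial sums of the squared Hilbert-Schmidt norm stay below the full sum by at
    -- least `D α / N.choose 2`, so this gap must vanish.
    have h1 : ∑' β, ‖A (delta β)‖ ^ 2 ≤ ∑' β, ‖A (delta β)‖ ^ 2 - D α / N.choose 2 := by
      refine hA.tsum_le_of_sum_le fun F => ?_
      have h2 := hF (insert α F)
      rw [Finset.sum_add_distrib, ← Finset.mul_sum] at h2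
      have h3 : D α ≤ ∑ β ∈ insert α F, D β :=
        Finset.single_le_sum (fun β _ => hD0 β) (Finset.mem_insert_self _ _)
      have h4 : ∑ β ∈ F, ‖A (delta β)‖ ^ 2 ≤ ∑ β ∈ insert α F, ‖A (delta β)‖ ^ 2 :=
        Finset.sum_le_sum_of_subset_of_nonneg (Finset.subset_insert _ _) fun _ _ _ => sq_nonneg _
      rw [le_sub_iff_add_le, ← mul_le_mul_iff_right₀ hM, mul_add, mul_div_cancel₀ _ hM.ne']
      have h5 := mul_le_mul_of_nonneg_left h4 hM.le
      linarith
    have h2 : D α / N.choose 2 ≤ 0 := by linarith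
    by_contra hpos
    exact absurd h2 (not_le.2 (div_pos (not_le.1 hpos) hM))
  have hfix : ∀ (p : Pair N) (σ : C) (α : Fin N → J),
      S.pairU p σ (A (star (S.pairU p σ) (delta α))) = A (delta α) := fun p σ α => by
    have := S.isOpenPosMeasure
    have h1 := (Finset.sum_eq_zero_iff_of_nonneg fun p _ => integral_nonneg fun σ =>
      sq_nonneg _).1 (hDz α) p (Finset.mem_univ p)
    have hc : Continuous fun σ =>
        ‖A (delta α) - S.pairU p σ (A (star (S.pairU p σ) (delta α)))‖ ^ 2 :=
      (continuous_const.sub (S.continuous_conj p A (delta α))).norm.pow 2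
    rw [integral_eq_zero_iff_of_nonneg (fun σ => sq_nonneg _)
      (hc.integrable_of_hasCompactSupport (HasCompactSupport.of_compactSpace _))] at h1
    -- A continuous function vanishing `ν`-almost everywhere vanishes everywhere, since `ν` charges
    -- open sets.
    have h2 := congrFun ((hc.ae_eq_iff_eq S.ν continuous_zero).1 h1) σ
    have h3 : ‖A (delta α) - S.pairU p σ (A (star (S.pairU p σ) (delta α)))‖ = 0 := by
      simpa using h2
    exact (sub_eq_zero.1 (norm_eq_zero.1 h3)).symm
  rintro _ ⟨p, σ, rfl⟩
  have h1 : S.pairU p σ * (A * star (S.pairU p σ)) = A := ext_delta fun α => hfix p σ α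
  have h2 := (Unitary.mem_iff.1 (S.pairU_mem_unitary p σ)).1
  calc S.pairU p σ * A = S.pairU p σ * (A * (star (S.pairU p σ) * S.pairU p σ)) := by
        rw [h2, mul_one]
    _ = S.pairU p σ * (A * star (S.pairU p σ)) * S.pairU p σ := by simp only [mul_assoc]
    _ = A * S.pairU p σ := by rw [h1]

end Fixed

/-! ### Decomposition into minimal projections -/

section Convex

variable {J : Type*} {e : J → ℝ} {C : Type*} [MetricSpace C] [CompactSpace C] [MeasurableSpace C]
  [BorelSpace C] {S : CollisionSpec e C} {N : ℕ}

theorem CollisionSpec.mem_conserved_of_hasSum {ι : Type*} {f : ι → HN J N →L[ℂ] HN J N}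
    {A : HN J N →L[ℂ] HN J N} (hf : ∀ i, f i ∈ S.conserved N) (h : HasSum f A) :
    A ∈ S.conserved N := fun W hW => by
  have h1 := h.mul_left W
  have h2 := h.mul_right W
  simp_rw [fun i => hf i W hW] at h1
  exact h1.unique h2

/-- The conserved density matrices are convex combinations of normalized minimal projections. -/
theorem CollisionSpec.IsErgodic.exists_hasSum_normalizedProj (hS : S.IsErgodic) (hN : 2 ≤ N)
    (hfin : ∀ α₀ : Fin N → J, {α | Equivalent e α₀ α}.Finite) {A : HN J N →L[ℂ] HN J N}
    (hA : A ∈ S.conserved N) {r : (Fin N → J) → ℝ} (hr : ∀ α, A (delta α) α = r α)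
    (hr0 : ∀ α, 0 ≤ r α) (hr1 : HasSum r 1) :
    ∃ w : {P : HN J N →L[ℂ] HN J N // S.IsMinimalProjection P} → ℝ,
      (∀ P, 0 ≤ w P) ∧ HasSum w 1 ∧
        HasSum (fun P => (w P : ℂ) • normalizedProj P.1) A := by
  obtain ⟨hd, hadj⟩ := hS.diagonal_of_mem_conserved hN hA
  have hind : ∀ α : Fin N → J, ActsAsIndicator (∑ᶠ β ∈ {β | Equivalent e α β},
      InnerProductSpace.rankOne ℂ (delta β) (delta β)) {β | Equivalent e α β} := fun α =>
    actsAsIndicator_finsum (hfin α)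
  -- The map from an index to the projection of its class is onto, with the classes as fibres; it
  -- parametrizes the minimal projections.
  let c : (Fin N → J) → {P : HN J N →L[ℂ] HN J N // S.IsMinimalProjection P} := fun α =>
    ⟨_, (hS.isMinimalProjection_iff hN hfin _).2 ⟨α, hind α⟩⟩
  have hc : ∀ α, ActsAsIndicator (c α).1 {β | Equivalent e α β} := hind
  have hsurj : Function.Surjective c := fun P => by
    obtain ⟨α, hα⟩ := (hS.isMinimalProjection_iff hN hfin _).1 P.2
    exact ⟨α, Subtype.ext ((hc α).unique hα)⟩
  have hfib : ∀ α, {β | c β = c α} = {β | Equivalent e α β} := fun α => by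
    ext β
    constructor
    · intro h
      have h1 : β ∈ {γ | Equivalent e β γ} := Relation.ReflTransGen.refl
      rw [(hc β).mem_iff, show c β = c α from h, ← (hc α).mem_iff] at h1
      exact h1
    · intro h
      refine Subtype.ext ((hc β).unique ?_)
      have : {γ | Equivalent e β γ} = {γ | Equivalent e α γ} := by
        ext γ
        exact ⟨fun h' => Relation.ReflTransGen.trans h h',
          fun h' => Relation.ReflTransGen.trans (Equivalent.symm h) h'⟩
      rw [this]
      exact hc α
  have hrconst : ∀ α β, c β = c α → r β = r α := fun α β h => by
    have h1 : Equivalent e α β := by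
      have : β ∈ {β | c β = c α} := h
      rwa [hfib] at this
    have := Equivalent.eq_of_adjacent hadj h1
    rw [hr, hr] at this
    exact_mod_cast this.symm
  -- The weight is `Tr (P A)`, the sum of the diagonal over the class; as `r` is constant there, it
  -- equals rank times that constant.
  let w : {P : HN J N →L[ℂ] HN J N // S.IsMinimalProjection P} → ℝ := fun P =>
    ∑' x : {α // c α = P}, r x.1
  have hw : ∀ α, w (c α) = Module.finrank ℂ (c α).1.range * r α := fun α => by
    have h1 : w (c α) = ∑' _ : {β // c β = c α}, r α := tsum_congr fun x => hrconst α x.1 x.2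
    rw [h1, tsum_const, nsmul_eq_mul, (hc α).finrank_range (hfin α), ← hfib α]
    rfl
  have hrank : ∀ α, (Module.finrank ℂ (c α).1.range : ℂ) ≠ 0 := fun α => by
    have := (hfin α).to_subtype
    have : Nonempty {β | Equivalent e α β} := ⟨⟨α, .refl⟩⟩
    rw [(hc α).finrank_range (hfin α)]
    exact Nat.cast_ne_zero.2 Nat.card_pos.ne'
  have hw0 : ∀ P, 0 ≤ w P := fun P => tsum_nonneg fun x => hr0 _
  have hw1 : HasSum w 1 := by
    have h1 : HasSum (fun x : Σ P, {α // c α = P} => r x.2.1) 1 :=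
      (Equiv.sigmaFiberEquiv c).hasSum_iff.2 hr1
    exact h1.sigma fun P => (hr1.summable.subtype _).hasSum
  -- A projection has norm at most one and rank at least one here, so the weights dominate the
  -- series in operator norm.
  have hnorm : ∀ P : {P : HN J N →L[ℂ] HN J N // S.IsMinimalProjection P},
      ‖(w P : ℂ) • normalizedProj P.1‖ ≤ w P := fun P => by
    obtain ⟨α, rfl⟩ := hsurj P
    rw [norm_smul, Complex.norm_real, Real.norm_of_nonneg (hw0 _)]
    refine mul_le_of_le_one_right (hw0 _) ?_
    rw [normalizedProj, norm_smul, norm_inv, Complex.norm_natCast]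
    have h1 : ‖(c α).1‖ ≤ 1 := (hc α).isStarProjection.norm_le
    have h2 : (1 : ℝ) ≤ Module.finrank ℂ (c α).1.range := by
      have : Module.finrank ℂ (c α).1.range ≠ 0 := by exact_mod_cast hrank α
      exact_mod_cast Nat.one_le_iff_ne_zero.2 this
    exact mul_le_one₀ (inv_le_one_of_one_le₀ h2) (norm_nonneg _) h1
  have hsum : Summable fun P : {P : HN J N →L[ℂ] HN J N // S.IsMinimalProjection P} =>
      (w P : ℂ) • normalizedProj P.1 :=
    Summable.of_norm_bounded hw1.summable hnorm
  refine ⟨w, hw0, hw1, ?_⟩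
  have heq : ∑' P : {P : HN J N →L[ℂ] HN J N // S.IsMinimalProjection P},
      (w P : ℂ) • normalizedProj P.1 = A := by
    -- On `delta α` only the term of the class of `α` survives, and the rank in `w` cancels the
    -- normalization.
    refine ext_delta fun α => ?_
    have h1 := hsum.hasSum.mapL (ContinuousLinearMap.apply ℂ (HN J N) (delta α))
    refine h1.unique ?_
    have h2 : A (delta α) = ContinuousLinearMap.apply ℂ (HN J N) (delta α)
        ((w (c α) : ℂ) • normalizedProj (c α).1) := by
      rw [ContinuousLinearMap.apply_apply, normalizedProj, _root_.smul_apply, _root_.smul_apply,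
        (hc α).apply_mem .refl, hd, hr, hw, smul_smul]
      congr 1
      push_cast
      field_simp [hrank α]
    rw [h2]
    refine hasSum_single _ fun P hP => ?_
    obtain ⟨β, rfl⟩ := hsurj P
    have h3 : α ∉ {γ | Equivalent e β γ} := by
      rw [← hfib]
      exact fun h => hP h.symm
    rw [ContinuousLinearMap.apply_apply, normalizedProj, _root_.smul_apply, _root_.smul_apply,
      (hc β).apply_notMem h3, smul_zero, smul_zero]
  rw [← heq]
  exact hsum.hasSum

end Convex

end QKac

/-! ### The main theorem -/

open QKac in
theorem theorem2p16 {H : Type*} [NormedAddCommGroup H] [InnerProductSpace ℂ H] [CompleteSpace H]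
    (h : H →ₗ.[ℂ] H) (hsa : IsSelfAdjoint h) (hres : HasCompactResolvent h)
    {J : Type*} (ψ : HilbertBasis J ℂ H) (e : J → ℝ)
    (he : ∀ j, ∃ hj : ψ j ∈ h.domain, h ⟨ψ j, hj⟩ = (e j : ℂ) • ψ j)
    (hbdd : BddBelow (Set.range e))
    {C : Type*} [MetricSpace C] [CompactSpace C] [MeasurableSpace C] [BorelSpace C]
    (S : CollisionSpec e C) (hS : S.IsErgodic) (N : ℕ) (hN : 2 ≤ N) :
    -- the equivalence classes of indices are finite
    (∀ α₀ : Fin N → J, {α | Equivalent e α₀ α}.Finite) ∧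
    -- the minimal projections are the sums over equivalence classes
    (∀ P : HN J N →L[ℂ] HN J N, S.IsMinimalProjection P ↔
      ∃ α₀ : Fin N → J, P = ∑ᶠ α ∈ {α | Equivalent e α₀ α},
        InnerProductSpace.rankOne ℂ (basisVec ψ α) (basisVec ψ α)) ∧
    -- in particular they can be normalized
    (∀ P : HN J N →L[ℂ] HN J N, S.IsMinimalProjection P →
      FiniteDimensional ℂ P.range ∧ IsDensityMatrix ψ (normalizedProj P)) ∧
    -- the steady states are the (countable) convex combinations of normalized minimal projections
    ∀ ρ : HN J N →L[ℂ] HN J N, IsDensityMatrix ψ ρ →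
      (S.kacGenerator ρ = 0 ↔
        ∃ w : {P : HN J N →L[ℂ] HN J N // S.IsMinimalProjection P} → ℝ,
          (∀ P, 0 ≤ w P) ∧ HasSum w 1 ∧
            HasSum (fun P => (w P : ℂ) • normalizedProj P.1) ρ) := by
  have hfin : ∀ α₀ : Fin N → J, {α | Equivalent e α₀ α}.Finite :=
    finite_setOf_equivalent hbdd (hres.finite_setOf_le ψ he hbdd)
  have hmin := hS.isMinimalProjection_iff hN hfin
  refine ⟨hfin, fun P => ?_, fun P hP => ?_, fun ρ hρ => ⟨fun h0 => ?_, ?_⟩⟩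
  · simp only [hmin, basisVec_eq_delta]
    refine exists_congr fun α₀ => ⟨fun hP => hP.unique (actsAsIndicator_finsum (hfin α₀)), ?_⟩
    rintro rfl
    exact actsAsIndicator_finsum (hfin α₀)
  · obtain ⟨α₀, hα₀⟩ := (hmin P).1 hP
    exact ⟨hα₀.finiteDimensional_range (hfin α₀),
      isDensityMatrix_normalizedProj ψ hα₀ (hfin α₀) ⟨α₀, .refl⟩⟩
  · obtain ⟨hpos, htr⟩ := hρ
    simp only [basisVec_eq_delta] at htr
    have htr1 : HasSum (fun α : Fin N → J => (⟪delta α, ρ (delta α)⟫_ℂ).re) 1 := by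
      simpa using Complex.hasSum_re htr
    obtain ⟨c, hc⟩ := norm_sq_apply_le_of_isPositive hpos
    have hHS : Summable fun α : Fin N → J => ‖ρ (delta α)‖ ^ 2 :=
      Summable.of_nonneg_of_le (fun _ => sq_nonneg _) (fun α => hc (delta α))
        (htr1.summable.mul_left c)
    refine hS.exists_hasSum_normalizedProj hN hfin
      (S.mem_conserved_of_kacGenerator_eq_zero hN hHS h0)
      (r := fun α => (⟪delta α, ρ (delta α)⟫_ℂ).re) (fun α => ?_)
      (fun α => hpos.re_inner_nonneg_right _) htr1
    rw [← inner_delta_left]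
    exact (hpos.isSymmetric.coe_re_inner_self_apply (delta α)).symm
  · rintro ⟨w, -, -, hw⟩
    -- Each term lies in the commutant, which is closed under norm-convergent sums.
    refine S.kacGenerator_eq_zero_of_mem_conserved hN
      (CollisionSpec.mem_conserved_of_hasSum (fun P => ?_) hw)
    intro W hW
    rw [normalizedProj, smul_smul, mul_smul_comm, smul_mul_assoc, P.2.1 W hW]
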